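/- Let $G=(V,E)$ be a finite graph, $J_{ij}=J_{ji}\ge 0$ for every edge $i\sim j$, and $h_i\ge 0$ for every $i\in V$ (a ferromagnetic Ising model with consistent field). Write $\theta_{ij}=\tanh(J_{ij})$ and $\partial i$ for the set of neighbours of $i$. For messages $\nu=(\nu_{i\to j})$, one for each ordered pair of neighbours, the belief propagation (BP) step is $$\phi(\nu)_{i\to j}=\tanh\Big(h_i+\sum_{k\in\partial i\setminus j}\tanh^{-1}(\theta_{ik}\,\nu_{k\to i})\Big),$$ and a BP fixed point is a $\nu$ with entries in $[-1,1]$ and $\phi(\nu)=\nu$. Put $S_{post}=\{\nu: 0\le\nu_{i\to j}\le\phi(\nu)_{i\to j}\text{ for all } i\sim j\}$. A locally consistent distribution $P$ consists of probability distributions $P_i$ on $\{\pm1\}$ for $i\in V$ and $P_{ij}$ on $\{\pm1\}^2$ for $i\sim j$ such that $P_{ij}$ has marginals $P_i$ and $P_j$. The Bethe free energy functional on locally consistent distributions is $$\Phi_{Bethe}(P)=\sum_{i\sim j}J_{ij}\,\mathbb E_{P_{ij}}[X_iX_j]+\sum_i h_i\,\mathbb E_{P_i}[X_i]+\sum_{i\sim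 j}H_{P_{ij}}(X_i,X_j)-\sum_i(\deg(i)-1)H_{P_i}(X_i),$$ with $H$ the Shannon entropy and $\sum_{i\sim j}$ the sum over undirected edges. The dual Bethe free energy is $\Phi^*_{Bethe}(\nu)=\sum_iF_i(\nu)-\sum_{i\sim j}F_{ij}(\nu)$, where $$F_i(\nu)=\log\Big[e^{h_i}\prod_{j\in\partial i}(1+\theta_{ij}\nu_{j\to i})+e^{-h_i}\prod_{j\in\partial i}(1-\theta_{ij}\nu_{j\to i})\Big]+\sum_{j\in\partial i}\log\cosh J_{ij},$$ $$F_{ij}(\nu)=\log(1+\theta_{ij}\nu_{i\to j}\nu_{j\to i})+\log\cosh J_{ij}.$$ The marginals corresponding to a BP fixed point $\nu$ are $$P_i(x_i)=\frac{1+\nu_ix_i}{2},\quad \nu_i=\tanh\Big(h_i+\sum_{k\in\partial i}\tanh^{-1}(\theta_{ik}\nu_{k\to i})\Big),\qquad P_{ij}(x_i,x_j)\propto e^{J_{ij}x_ix_j}(1+\nu_{i\to j}x_i)(1+\nu_{j\to i}x_j).$$ **Theorem.** Let $\nu^{(0)}_{i\to j}=1$ for all $i\sim j$ and $\nu^{(t+1)}=\phi(\nu^{(t)})$.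 Then $\nu^{(t)}$ is coordinatewise non-increasing in $t$ and converges to a BP fixed point $\nu^*\ge 0$, which is the greatest BP fixed point: $\mu_{i\to j}\le\nu^*_{i\to j}$ for every BP fixed point $\mu$ and all $i\sim j$. Moreover $\nu^*\in S_{post}$ and $\Phi^*_{Bethe}(\nu^*)=\max_{\nu\in S_{post}}\Phi^*_{Bethe}(\nu)$. The marginals $P$ corresponding to $\nu^*$ form a locally consistent distribution, $P$ is a global maximizer of $\Phi_{Bethe}$ over all locally consistent distributions, and $\Phi_{Bethe}(P)=\Phi^*_{Bethe}(\nu^*)$. (No uniqueness of BP fixed points or of the maximizer is assumed.) -/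

import Mathlib

open Filter Topology

noncomputable section

namespace IsingBP

variable {V : Type*} [Fintype V] [DecidableEq V]

/-- The real value `±1` of a spin. -/
def spin (x : ℤˣ) : ℝ := ((x : ℤ) : ℝ)

/-- The edge parameter `θ_ij = tanh J_ij`; the directed edge `d` stands for `i → j` with
`i = d.fst` and `j = d.snd`. -/
def theta (G : SimpleGraph V) (J : V → V → ℝ) (d : G.Dart) : ℝ := Real.tanh (J d.fst d.snd)

/-- The directed edges `k → i` with head `i`, that is, `k` ranges over the neighbours of `i`. -/
def incoming (G : SimpleGraph V) [DecidableRel G.Adj] (i : V) : Finset G.Dart :=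
  Finset.univ.filter fun e => e.snd = i

/-- The sum of `f` over the undirected edges of `G`, for a function `f` of directed edges with
`f d.symm = f d`: each undirected edge is counted once in each direction and halved. -/
def edgeSum (G : SimpleGraph V) [DecidableRel G.Adj] (f : G.Dart → ℝ) : ℝ :=
  (1 / 2) * ∑ d, f d

/-! ### Belief propagation -/

/-- One step of belief propagation, `ν ↦ φ(ν)`:
`φ(ν)_{i → j} = tanh (h_i + ∑_{k ∈ ∂i \ j} artanh (tanh (J_ik) ν_{k → i}))`. -/
def bpStep (G : SimpleGraph V) [DecidableRel G.Adj] (J : V → V → ℝ) (h : V → ℝ)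
    (ν : G.Dart → ℝ) : G.Dart → ℝ := fun d =>
  Real.tanh (h d.fst +
    ∑ e ∈ (incoming G d.fst).filter (fun e => e.fst ≠ d.snd), Real.artanh (theta G J e * ν e))

/-- The messages after `t` steps of belief propagation from the all-ones initialization. -/
def bpIter (G : SimpleGraph V) [DecidableRel G.Adj] (J : V → V → ℝ) (h : V → ℝ) (t : ℕ) :
    G.Dart → ℝ :=
  (bpStep G J h)^[t] (fun _ => 1)

/-- Fixed points of belief propagation: messages in `[-1, 1]` that solve the BP equations. -/
def bpFixedPoints (G : SimpleGraph V) [DecidableRel G.Adj] (J : V → V → ℝ) (h : V → ℝ) :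
    Set (G.Dart → ℝ) :=
  {ν | (∀ d, ν d ∈ Set.Icc (-1 : ℝ) 1) ∧ bpStep G J h ν = ν}

/-- The post-fixpoints `0 ≤ ν ≤ φ(ν)` (coordinatewise). -/
def postFixpoints (G : SimpleGraph V) [DecidableRel G.Adj] (J : V → V → ℝ) (h : V → ℝ) :
    Set (G.Dart → ℝ) :=
  {ν | 0 ≤ ν ∧ ν ≤ bpStep G J h ν}

/-! ### The Bethe free energy -/

/-- Candidate node marginals `P_i` and edge marginals `P_ij`; in `edge d x y` the spin `x` sits at
`d.fst` and the spin `y` at `d.snd`. -/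
structure Marginals (G : SimpleGraph V) where
  node : V → ℤˣ → ℝ
  edge : G.Dart → ℤˣ → ℤˣ → ℝ

/-- The polytope of locally consistent distributions. -/
structure IsLocallyConsistent (G : SimpleGraph V) (P : Marginals G) : Prop where
  node_nonneg : ∀ i x, 0 ≤ P.node i x
  node_sum : ∀ i, ∑ x, P.node i x = 1
  edge_nonneg : ∀ d x y, 0 ≤ P.edge d x y
  /-- `P_ij` and `P_ji` are the same joint distribution. -/
  edge_symm : ∀ d x y, P.edge d.symm y x = P.edge d x y
  edge_marginal : ∀ d y, ∑ x, P.edge d x y = P.node d.snd y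

/-- `E_{P_i}[X_i]`. -/
def nodeMean {G : SimpleGraph V} (P : Marginals G) (i : V) : ℝ := ∑ x, P.node i x * spin x

/-- `E_{P_ij}[X_i X_j]`. -/
def edgeCorr {G : SimpleGraph V} (P : Marginals G) (d : G.Dart) : ℝ :=
  ∑ x, ∑ y, P.edge d x y * (spin x * spin y)

/-- The entropy `H_{P_i}(X_i)`. -/
def nodeEntropy {G : SimpleGraph V} (P : Marginals G) (i : V) : ℝ :=
  ∑ x, Real.negMulLog (P.node i x)

/-- The joint entropy `H_{P_ij}(X_i, X_j)`. -/
def edgeEntropy {G : SimpleGraph V} (P : Marginals G) (d : G.Dart) : ℝ :=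
  ∑ x, ∑ y, Real.negMulLog (P.edge d x y)

/-- The Bethe free energy functional `Φ_Bethe(P)`. -/
def betheFreeEnergy (G : SimpleGraph V) [DecidableRel G.Adj] (J : V → V → ℝ) (h : V → ℝ)
    (P : Marginals G) : ℝ :=
  edgeSum G (fun d => J d.fst d.snd * edgeCorr P d) + ∑ i, h i * nodeMean P i +
    edgeSum G (fun d => edgeEntropy P d) - ∑ i, ((G.degree i : ℝ) - 1) * nodeEntropy P i

/-- The vertex term `F_i(ν)` of the dual Bethe free energy. -/
def dualVertexTerm (G : SimpleGraph V) [DecidableRel G.Adj] (J : V → V → ℝ) (h : V → ℝ)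
    (ν : G.Dart → ℝ) (i : V) : ℝ :=
  Real.log (Real.exp (h i) * ∏ e ∈ incoming G i, (1 + theta G J e * ν e) +
      Real.exp (-h i) * ∏ e ∈ incoming G i, (1 - theta G J e * ν e)) +
    ∑ e ∈ incoming G i, Real.log (Real.cosh (J e.fst e.snd))

/-- The edge term `F_ij(ν)` of the dual Bethe free energy. -/
def dualEdgeTerm (G : SimpleGraph V) (J : V → V → ℝ) (ν : G.Dart → ℝ) (d : G.Dart) : ℝ :=
  Real.log (1 + theta G J d * ν d * ν d.symm) + Real.log (Real.cosh (J d.fst d.snd))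

/-- The dual Bethe free energy `Φ*_Bethe(ν)`, the BP estimate of the free energy. -/
def dualBetheFreeEnergy (G : SimpleGraph V) [DecidableRel G.Adj] (J : V → V → ℝ) (h : V → ℝ)
    (ν : G.Dart → ℝ) : ℝ :=
  ∑ i, dualVertexTerm G J h ν i - edgeSum G (dualEdgeTerm G J ν)

/-! ### The distribution that corresponds to a family of messages -/

/-- The BP estimate `ν_i = tanh (h_i + ∑_{k ∈ ∂i} artanh (tanh (J_ik) ν_{k → i}))` of `E[X_i]`. -/
def bpMean (G : SimpleGraph V) [DecidableRel G.Adj] (J : V → V → ℝ) (h : V → ℝ)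
    (ν : G.Dart → ℝ) (i : V) : ℝ :=
  Real.tanh (h i + ∑ e ∈ incoming G i, Real.artanh (theta G J e * ν e))

/-- The unnormalized edge weight `e^{J_ij x y} (1 + ν_{i → j} x) (1 + ν_{j → i} y)`, which is
proportional to `e^{J_ij x y + λ_{i → j} x + λ_{j → i} y}` when `ν = tanh λ`. -/
def edgeWeight (G : SimpleGraph V) (J : V → V → ℝ) (ν : G.Dart → ℝ) (d : G.Dart)
    (x y : ℤˣ) : ℝ :=
  Real.exp (J d.fst d.snd * (spin x * spin y)) * (1 + ν d * spin x) * (1 + ν d.symm * spin y)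

/-- The marginals that correspond to the messages `ν`: `P_i` is the law on `{±1}` with mean `ν_i`,
and `P_ij` is the normalized edge weight. -/
def beliefs (G : SimpleGraph V) [DecidableRel G.Adj] (J : V → V → ℝ) (h : V → ℝ)
    (ν : G.Dart → ℝ) : Marginals G where
  node i x := (1 + bpMean G J h ν i * spin x) / 2
  edge d x y := edgeWeight G J ν d x y / ∑ x', ∑ y', edgeWeight G J ν d x' y'

end IsingBP

end

open Filter Topology

noncomputable section

namespace IsingBP

variable {V : Type*} {G : SimpleGraph V} {J : V → V → ℝ} {h : V → ℝ}

/-! ### Hyperbolic tangents of sums -/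

/-! On messages in $[-1,1]$ the BP map is monotone, so its iterates from the all-ones messages
decrease to a fixed point that dominates every post-fixpoint and every fixed point
(`exists_tendsto_bpIter`). Two facts then give the theorem.

The dual free energy increases along $S_{post}$. In the direction $\delta$ its derivative is a sum
over directed edges of $\theta\delta_{i\to j}$ times the difference between $x/(1+\theta\nu_{i\to
j}x)$ at $x=\phi(\nu)_{j\to i}$ and at $x=\nu_{j\to i}$. This function increases in $x$, so the
derivative is nonnegative for $\delta\ge 0$ at a post-fixpoint. The segment from a post-fixpoint up
to $\nu^*$ stays in $S_{post}$, because $\phi$ is concave along increasing segments of nonnegative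
messages (`segment_mem_postFixpoints`). Hence $\nu^*$ is optimal in $S_{post}$.

The Bethe free energy of any locally consistent distribution is bounded by dual values on
$S_{post}$. Keep the node means in $[-r,r]$ with $r<1$ and take a maximizer; taking absolute values
of all moments makes its means nonnegative. On each edge, messages $\nu$ reproduce the two means
(`exists_edgeMean_eq`), and by Gibbs' inequality the edge law built from them is optimal for these
means. Lowering a single mean is always admissible, and the first-order condition for it says
exactly $\nu\le\phi(\nu)$ (`artanh_le_of_maximizer`). Gibbs' inequality at the vertices bounds the
free energy by the dual value at $\nu$ (`betheFreeEnergy_le_dual`). Raising negative messages to $0$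
gives a post-fixpoint without lowering that value (`dualBetheFreeEnergy_le_sup_zero`). Letting
$r\to1$ covers all distributions. At a BP fixed point both uses of Gibbs' inequality are equalities,
so the beliefs of $\nu^*$ attain the bound. -/

lemma tanh_le_tanh {x y : ℝ} (hxy : x ≤ y) : Real.tanh x ≤ Real.tanh y := by
  rw [← Real.artanh_le_artanh_iff ⟨Real.neg_one_lt_tanh x, Real.tanh_lt_one x⟩
    ⟨Real.neg_one_lt_tanh y, Real.tanh_lt_one y⟩, Real.artanh_tanh, Real.artanh_tanh]
  exact hxy

lemma tanh_nonneg {x : ℝ} (hx : 0 ≤ x) : 0 ≤ Real.tanh x := by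
  simpa using tanh_le_tanh hx

lemma abs_mul_lt_one {a b : ℝ} (ha : |a| < 1) (hb : |b| ≤ 1) : |a * b| < 1 := by
  rw [abs_mul]
  nlinarith [abs_nonneg a, abs_nonneg b]

/-- `e^h ∏ (1 + x_e)`, the weight of a plus spin in a field `h` with messages `x`. -/
def plusWeight {ι : Type*} (h : ℝ) (S : Finset ι) (x : ι → ℝ) : ℝ :=
  Real.exp h * ∏ e ∈ S, (1 + x e)

lemma plusWeight_pos {ι : Type*} (h : ℝ) {S : Finset ι} {x : ι → ℝ}
    (hx : ∀ e ∈ S, |x e| < 1) : 0 < plusWeight h S x :=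
  mul_pos (Real.exp_pos h) (Finset.prod_pos fun e he => by linarith [(abs_lt.1 (hx e he)).1])

lemma plusWeight_neg {ι : Type*} (h : ℝ) (S : Finset ι) (x : ι → ℝ) :
    plusWeight (-h) S (-x) = Real.exp (-h) * ∏ e ∈ S, (1 - x e) := by
  simp [plusWeight, sub_eq_add_neg]

lemma plusWeight_neg_pos {ι : Type*} (h : ℝ) {S : Finset ι} {x : ι → ℝ}
    (hx : ∀ e ∈ S, |x e| < 1) : 0 < plusWeight (-h) S (-x) :=
  plusWeight_pos _ fun e he => by simpa using hx e he

lemma plusWeight_erase {ι : Type*} [DecidableEq ι] (h : ℝ) {S : Finset ι} (x : ι → ℝ) {e : ι}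
    (he : e ∈ S) : plusWeight h S x = plusWeight h (S.erase e) x * (1 + x e) := by
  rw [plusWeight, plusWeight, mul_assoc, ← Finset.mul_prod_erase S (fun e => 1 + x e) he,
    mul_comm (1 + x e)]

lemma exp_add_sum_artanh {ι : Type*} (h : ℝ) (S : Finset ι) (x : ι → ℝ)
    (hx : ∀ e ∈ S, |x e| < 1) :
    Real.exp (2 * (h + ∑ e ∈ S, Real.artanh (x e))) =
      plusWeight h S x / plusWeight (-h) S (-x) := by
  have h1 : ∀ e ∈ S, Real.exp (2 * Real.artanh (x e)) = (1 + x e) / (1 - x e) := by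
    intro e he
    obtain ⟨h1, h2⟩ := abs_lt.1 (hx e he)
    rw [two_mul, Real.exp_add, Real.exp_artanh ⟨h1, h2⟩,
      Real.mul_self_sqrt (div_nonneg (by linarith) (by linarith))]
  rw [mul_add, Finset.mul_sum, Real.exp_add, Real.exp_sum, Finset.prod_congr rfl h1,
    Finset.prod_div_distrib, plusWeight_neg, plusWeight, two_mul, Real.exp_add, Real.exp_neg]
  have : ∏ e ∈ S, (1 - x e) ≠ 0 :=
    Finset.prod_ne_zero_iff.2 fun e he => by linarith [(abs_lt.1 (hx e he)).2]
  field_simp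

lemma tanh_eq_exp_two_mul (x : ℝ) :
    Real.tanh x = (Real.exp (2 * x) - 1) / (Real.exp (2 * x) + 1) := by
  rw [Real.tanh_eq, two_mul, Real.exp_add, Real.exp_neg]
  field_simp

/-- Links the BP update to the dual vertex term: the update is the mean of a spin with weights
$e^{\pm h}\prod(1\pm x_e)$, and the vertex term is the logarithm of their sum. -/
lemma tanh_add_sum_artanh {ι : Type*} (h : ℝ) (S : Finset ι) (x : ι → ℝ)
    (hx : ∀ e ∈ S, |x e| < 1) :
    Real.tanh (h + ∑ e ∈ S, Real.artanh (x e)) =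
      (plusWeight h S x - plusWeight (-h) S (-x)) /
        (plusWeight h S x + plusWeight (-h) S (-x)) := by
  have := plusWeight_pos h hx
  have := plusWeight_neg_pos h hx
  rw [tanh_eq_exp_two_mul, exp_add_sum_artanh h S x hx]
  field_simp

lemma tanh_add_artanh (u : ℝ) {x : ℝ} (hx : |x| < 1) :
    Real.tanh (u + Real.artanh x) = (Real.tanh u + x) / (1 + Real.tanh u * x) := by
  have h1 := tanh_add_sum_artanh u {()} (fun _ => x) (by simpa using hx)
  simp only [plusWeight, Finset.sum_singleton, Finset.prod_singleton, Pi.neg_apply] at h1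
  rw [h1, Real.tanh_eq]
  have h2 : 0 < Real.exp u := Real.exp_pos u
  have h3 : 0 < Real.exp (-u) := Real.exp_pos (-u)
  obtain ⟨h4, h5⟩ := abs_lt.1 hx
  have h6 : 0 < Real.exp u * (1 + x) + Real.exp (-u) * (1 - x) :=
    add_pos (mul_pos h2 (by linarith)) (mul_pos h3 (by linarith))
  generalize Real.exp u = p at *
  generalize Real.exp (-u) = q at *
  have h7 : 1 + (p - q) / (p + q) * x = (p * (1 + x) + q * (1 - x)) / (p + q) := by
    field_simp; ring
  have h8 : (p - q) / (p + q) + x = (p * (1 + x) - q * (1 - x)) / (p + q) := by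
    field_simp; ring
  rw [h7, h8, div_div_div_cancel_right₀ (by positivity), sub_eq_add_neg 1 x]

/-- The operation `(a + b) / (1 + a b)` on `[0, 1)` is concave along increasing segments. -/
lemma segment_le_tanhAdd {a₀ a₁ b₀ b₁ s : ℝ} (ha₀ : 0 ≤ a₀) (ha : a₀ ≤ a₁) (ha₁ : a₁ ≤ 1)
    (hb₀ : 0 ≤ b₀) (hb : b₀ ≤ b₁) (hb₁ : b₁ ≤ 1) (hs₀ : 0 ≤ s) (hs₁ : s ≤ 1) :
    (1 - s) * ((a₀ + b₀) / (1 + a₀ * b₀)) + s * ((a₁ + b₁) / (1 + a₁ * b₁)) ≤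
      (((1 - s) * a₀ + s * a₁) + ((1 - s) * b₀ + s * b₁)) /
        (1 + ((1 - s) * a₀ + s * a₁) * ((1 - s) * b₀ + s * b₁)) := by
  obtain ⟨p, rfl⟩ : ∃ p, a₁ = a₀ + p := ⟨a₁ - a₀, by ring⟩
  obtain ⟨q, rfl⟩ : ∃ q, b₁ = b₀ + q := ⟨b₁ - b₀, by ring⟩
  have hp : 0 ≤ p := by linarith
  have hq : 0 ≤ q := by linarith
  -- The increment from time $0$ to $s$ is $s(X-sY)/(D_0D_s)$, where $D_s$ is the denominator at
  -- time $s$. Its slope decreases in $s$: the numerator falls and the denominator grows.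
  -- Nonnegativity of $X-Y$ lets the quotients be compared factorwise.
  set X := p * (1 - b₀ ^ 2) + q * (1 - a₀ ^ 2) with hX
  set Y := p * q * (a₀ + b₀) with hY
  have hY0 : 0 ≤ Y := by positivity
  have hXY : 0 ≤ X - Y := by
    have e1 : 0 ≤ p * (b₀ * (1 - b₀ - q)) :=
      mul_nonneg hp (mul_nonneg hb₀ (by linarith))
    have e2 : 0 ≤ q * (a₀ * (1 - a₀ - p)) :=
      mul_nonneg hq (mul_nonneg ha₀ (by linarith))
    have e3 : 0 ≤ p * (1 - b₀) := mul_nonneg hp (by linarith)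
    have e4 : 0 ≤ q * (1 - a₀) := mul_nonneg hq (by linarith)
    rw [hX, hY]; nlinarith
  set D₀ := 1 + a₀ * b₀ with hD₀
  set E := a₀ * q + b₀ * p with hE
  have hD0 : 0 < D₀ := by positivity
  have hE0 : 0 ≤ E := by positivity
  have hF0 : 0 ≤ p * q := by positivity
  have hDs : 0 < D₀ + s * E + s ^ 2 * (p * q) := by positivity
  have hD1 : 0 < D₀ + E + p * q := by positivity
  have r1 : (a₀ + p + (b₀ + q)) / (1 + (a₀ + p) * (b₀ + q)) =
      (a₀ + b₀) / D₀ + (X - Y) / (D₀ * (D₀ + E + p * q)) := by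
    have : 1 + (a₀ + p) * (b₀ + q) = D₀ + E + p * q := by rw [hD₀, hE]; ring
    rw [this]; field_simp; rw [hX, hY, hD₀, hE]; ring
  have r2 : (((1 - s) * a₀ + s * (a₀ + p)) + ((1 - s) * b₀ + s * (b₀ + q))) /
        (1 + ((1 - s) * a₀ + s * (a₀ + p)) * ((1 - s) * b₀ + s * (b₀ + q))) =
      (a₀ + b₀) / D₀ + s * ((X - s * Y) / (D₀ * (D₀ + s * E + s ^ 2 * (p * q)))) := by
    have : 1 + ((1 - s) * a₀ + s * (a₀ + p)) * ((1 - s) * b₀ + s * (b₀ + q)) =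
      D₀ + s * E + s ^ 2 * (p * q) := by rw [hD₀, hE]; ring
    rw [this]; field_simp; rw [hX, hY, hD₀, hE]; ring
  rw [r1, r2]
  have key : (X - Y) / (D₀ * (D₀ + E + p * q)) ≤
      (X - s * Y) / (D₀ * (D₀ + s * E + s ^ 2 * (p * q))) := by
    have hs2 : s ^ 2 ≤ 1 := by nlinarith
    apply div_le_div₀
    · nlinarith
    · nlinarith
    · positivity
    · have := mul_le_mul_of_nonneg_right hs₁ hE0
      have := mul_le_mul_of_nonneg_right hs2 hF0
      exact mul_le_mul_of_nonneg_left (by linarith) hD0.le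
  have := mul_le_mul_of_nonneg_left key hs₀
  linarith

/-- Each summand acts on the partial result $a$ by $(a+z)/(1+az)$, so concavity propagates by
induction: the two-variable inequality handles the new summand, and monotonicity in $a$ absorbs the
induction hypothesis. -/
lemma segment_le_tanh_add_sum_artanh {ι : Type*} {h : ℝ} (hh : 0 ≤ h) (S : Finset ι)
    {x y : ι → ℝ} (hx : ∀ e ∈ S, 0 ≤ x e) (hxy : ∀ e ∈ S, x e ≤ y e) (hy : ∀ e ∈ S, y e < 1)
    {s : ℝ} (hs₀ : 0 ≤ s) (hs₁ : s ≤ 1) :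
    (1 - s) * Real.tanh (h + ∑ e ∈ S, Real.artanh (x e)) +
        s * Real.tanh (h + ∑ e ∈ S, Real.artanh (y e)) ≤
      Real.tanh (h + ∑ e ∈ S, Real.artanh ((1 - s) * x e + s * y e)) := by
  classical
  induction S using Finset.induction_on with
  | empty => simp; linarith
  | insert e S he ih =>
    simp only [Finset.forall_mem_insert] at hx hxy hy
    specialize ih hx.2 hxy.2 hy.2
    have swap : ∀ z : ι → ℝ, h + ∑ e ∈ insert e S, Real.artanh (z e) =
        (h + ∑ e ∈ S, Real.artanh (z e)) + Real.artanh (z e) := by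
      intro z; rw [Finset.sum_insert he]; ring
    have hz : (1 - s) * x e + s * y e < 1 := by nlinarith [hx.1, hxy.1, hy.1]
    have hz0 : 0 ≤ (1 - s) * x e + s * y e := by nlinarith [hx.1, hxy.1, hy.1]
    rw [swap x, swap y, swap fun e => (1 - s) * x e + s * y e,
      tanh_add_artanh _ (abs_lt.2 ⟨by linarith [hx.1], by linarith [hxy.1, hy.1]⟩),
      tanh_add_artanh _ (abs_lt.2 ⟨by linarith [hx.1, hxy.1], hy.1⟩),
      tanh_add_artanh _ (abs_lt.2 ⟨by linarith, hz⟩)]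
    have hxS : 0 ≤ ∑ e ∈ S, Real.artanh (x e) :=
      Finset.sum_nonneg fun e he => Real.artanh_nonneg (hx.2 e he)
    have hxyS : ∑ e ∈ S, Real.artanh (x e) ≤ ∑ e ∈ S, Real.artanh (y e) :=
      Finset.sum_le_sum fun e he =>
        Real.artanh_le_artanh (by linarith [hx.2 e he]) (hy.2 e he) (hxy.2 e he)
    have t0 : 0 ≤ Real.tanh (h + ∑ e ∈ S, Real.artanh (x e)) := tanh_nonneg (by linarith)
    have t1 : Real.tanh (h + ∑ e ∈ S, Real.artanh (x e)) ≤
      Real.tanh (h + ∑ e ∈ S, Real.artanh (y e)) := tanh_le_tanh (by linarith)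
    refine (segment_le_tanhAdd t0 t1 (Real.tanh_lt_one _).le hx.1 hxy.1 hy.1.le hs₀ hs₁).trans ?_
    set a := (1 - s) * Real.tanh (h + ∑ e ∈ S, Real.artanh (x e)) +
        s * Real.tanh (h + ∑ e ∈ S, Real.artanh (y e))
    have ha : 0 ≤ a := add_nonneg (mul_nonneg (by linarith) t0) (mul_nonneg hs₀ (t0.trans t1))
    rw [div_le_div_iff₀ (by positivity) (by have := ha.trans ih; positivity)]
    -- After cross-multiplication, the difference for $a\le a'$ is $(a'-a)(1-z^2)$.
    nlinarith [mul_nonneg (sub_nonneg.2 ih) (by nlinarith :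
      0 ≤ 1 - ((1 - s) * x e + s * y e) ^ 2)]

/-! ### The belief propagation dynamics -/

lemma continuousAt_artanh {x : ℝ} (hx : |x| < 1) : ContinuousAt Real.artanh x := by
  obtain ⟨h1, h2⟩ := abs_lt.1 hx
  unfold Real.artanh
  have h3 := (Real.sqrt_pos.2
    (div_pos (by linarith : 0 < 1 + x) (by linarith : 0 < 1 - x))).ne'
  have : 1 - x ≠ 0 := by linarith
  fun_prop (disch := assumption)

lemma continuous_tanh : Continuous Real.tanh := by
  have : Real.tanh = fun x => (Real.exp x - Real.exp (-x)) / (Real.exp x + Real.exp (-x)) :=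
    funext Real.tanh_eq
  rw [this]
  have : ∀ x : ℝ, Real.exp x + Real.exp (-x) ≠ 0 := fun x => by positivity
  fun_prop (disch := assumption)

lemma theta_nonneg (hJ : ∀ i j, G.Adj i j → 0 ≤ J i j) (d : G.Dart) : 0 ≤ theta G J d :=
  tanh_nonneg (hJ _ _ d.adj)

lemma theta_symm (hs : ∀ i j, G.Adj i j → J i j = J j i) (d : G.Dart) :
    theta G J d.symm = theta G J d := by
  simp [theta, hs _ _ d.adj]

lemma abs_theta_lt_one (d : G.Dart) : |theta G J d| < 1 := Real.abs_tanh_lt_one _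

lemma abs_theta_mul_lt_one {x : ℝ} (d : G.Dart) (hx : |x| ≤ 1) : |theta G J d * x| < 1 :=
  abs_mul_lt_one (abs_theta_lt_one d) hx

lemma abs_le_one_of_mem {ν : G.Dart → ℝ} (hν : 0 ≤ ν ∧ ν ≤ 1) (d : G.Dart) : |ν d| ≤ 1 :=
  abs_le.2 ⟨by have := hν.1 d; simp at this; linarith, hν.2 d⟩

section dynamics

variable [Fintype V] [DecidableEq V] [DecidableRel G.Adj]

lemma mem_incoming {i : V} {e : G.Dart} : e ∈ incoming G i ↔ e.snd = i := by
  simp [incoming]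

lemma symm_mem_incoming (d : G.Dart) : d.symm ∈ incoming G d.fst := by
  simp [mem_incoming]

lemma incoming_filter (d : G.Dart) :
    (incoming G d.fst).filter (fun e => e.fst ≠ d.snd) = (incoming G d.fst).erase d.symm := by
  ext e
  simp only [Finset.mem_filter, Finset.mem_erase, mem_incoming]
  constructor
  · rintro ⟨h1, h2⟩
    exact ⟨fun h3 => h2 (by simp [h3]), h1⟩
  · rintro ⟨h1, h2⟩
    refine ⟨h2, fun h3 => h1 ?_⟩
    ext <;> simp [h2, h3]

lemma bpStep_apply (ν : G.Dart → ℝ) (d : G.Dart) :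
    bpStep G J h ν d = Real.tanh (h d.fst +
      ∑ e ∈ (incoming G d.fst).erase d.symm, Real.artanh (theta G J e * ν e)) := by
  rw [bpStep, incoming_filter]

lemma abs_bpStep_lt_one (ν : G.Dart → ℝ) (d : G.Dart) : |bpStep G J h ν d| < 1 :=
  Real.abs_tanh_lt_one _

lemma bpStep_mono (hJ : ∀ i j, G.Adj i j → 0 ≤ J i j) {ν μ : G.Dart → ℝ}
    (hν : ∀ d, |ν d| ≤ 1) (hμ : ∀ d, |μ d| ≤ 1) (hle : ν ≤ μ) :
    bpStep G J h ν ≤ bpStep G J h μ := by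
  intro d
  rw [bpStep_apply, bpStep_apply]
  refine tanh_le_tanh (add_le_add_right (Finset.sum_le_sum fun e _ => ?_) _)
  exact Real.artanh_le_artanh (abs_lt.1 (abs_theta_mul_lt_one e (hν e))).1
    (abs_lt.1 (abs_theta_mul_lt_one e (hμ e))).2
    (mul_le_mul_of_nonneg_left (hle e) (theta_nonneg hJ e))

lemma bpStep_nonneg (hJ : ∀ i j, G.Adj i j → 0 ≤ J i j) (hh : ∀ i, 0 ≤ h i) {ν : G.Dart → ℝ}
    (hν : 0 ≤ ν) : 0 ≤ bpStep G J h ν := fun _ =>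
  tanh_nonneg (add_nonneg (hh _) (Finset.sum_nonneg fun e _ =>
    Real.artanh_nonneg (mul_nonneg (theta_nonneg hJ e) (hν e))))

lemma tendsto_bpStep {ν : ℕ → G.Dart → ℝ} {μ : G.Dart → ℝ} (hμ : ∀ d, |μ d| ≤ 1)
    (hν : Tendsto ν atTop (𝓝 μ)) :
    Tendsto (fun t => bpStep G J h (ν t)) atTop (𝓝 (bpStep G J h μ)) := by
  rw [tendsto_pi_nhds] at hν ⊢
  intro d
  simp only [bpStep_apply]
  refine (continuous_tanh.tendsto _).comp (tendsto_const_nhds.add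
    (tendsto_finsetSum _ fun e _ => ?_))
  exact (continuousAt_artanh (abs_theta_mul_lt_one e (hμ e))).tendsto.comp
    ((hν e).const_mul _)

lemma bpIter_succ (t : ℕ) : bpIter G J h (t + 1) = bpStep G J h (bpIter G J h t) :=
  Function.iterate_succ_apply' _ _ _

lemma bpIter_mem (hJ : ∀ i j, G.Adj i j → 0 ≤ J i j) (hh : ∀ i, 0 ≤ h i) (t : ℕ) :
    0 ≤ bpIter G J h t ∧ bpIter G J h t ≤ 1 := by
  induction t with
  | zero => exact ⟨fun _ => zero_le_one, le_rfl⟩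
  | succ t ih =>
    rw [bpIter_succ]
    exact ⟨bpStep_nonneg hJ hh ih.1, fun _ => (Real.tanh_lt_one _).le⟩

lemma antitone_bpIter (hJ : ∀ i j, G.Adj i j → 0 ≤ J i j) (hh : ∀ i, 0 ≤ h i) :
    Antitone (bpIter G J h) := by
  refine antitone_nat_of_succ_le fun t => ?_
  induction t with
  | zero => exact (bpIter_mem hJ hh 1).2
  | succ t ih =>
    rw [bpIter_succ (t + 1), bpIter_succ t]
    rw [bpIter_succ t] at ih
    have h1 := bpIter_mem hJ hh (t + 1)
    rw [bpIter_succ t] at h1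
    exact bpStep_mono hJ (abs_le_one_of_mem h1) (abs_le_one_of_mem (bpIter_mem hJ hh t)) ih

/-- There is no sign condition on `ν`, so this covers post-fixpoints as well as fixed points with
negative entries. -/
lemma le_bpIter (hJ : ∀ i j, G.Adj i j → 0 ≤ J i j) (hh : ∀ i, 0 ≤ h i) {ν : G.Dart → ℝ}
    (hν : ∀ d, |ν d| ≤ 1) (hle : ν ≤ bpStep G J h ν) (t : ℕ) : ν ≤ bpIter G J h t := by
  induction t with
  | zero => exact fun d => (abs_le.1 (hν d)).2
  | succ t ih =>
    rw [bpIter_succ]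
    exact hle.trans (bpStep_mono hJ hν (abs_le_one_of_mem (bpIter_mem hJ hh t)) ih)

/-- The iterates converge to a nonnegative fixed point that dominates every post-fixpoint. -/
lemma exists_tendsto_bpIter (hJ : ∀ i j, G.Adj i j → 0 ≤ J i j) (hh : ∀ i, 0 ≤ h i) :
    ∃ μ : G.Dart → ℝ, Tendsto (bpIter G J h) atTop (𝓝 μ) ∧ 0 ≤ μ ∧ bpStep G J h μ = μ ∧
      ∀ ν : G.Dart → ℝ, (∀ d, |ν d| ≤ 1) → ν ≤ bpStep G J h ν → ν ≤ μ := by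
  have hanti := antitone_bpIter (G := G) hJ hh
  have hlim : Tendsto (bpIter G J h) atTop (𝓝 (⨅ t, bpIter G J h t)) :=
    tendsto_atTop_ciInf hanti ⟨0, by rintro _ ⟨t, rfl⟩; exact (bpIter_mem hJ hh t).1⟩
  set μ := ⨅ t, bpIter G J h t
  have h0 : 0 ≤ μ := ge_of_tendsto' hlim fun t => (bpIter_mem hJ hh t).1
  have h1 : μ ≤ 1 := le_of_tendsto' hlim fun t => (bpIter_mem hJ hh t).2
  refine ⟨μ, hlim, h0, ?_, fun ν hν hle => ge_of_tendsto' hlim (le_bpIter hJ hh hν hle)⟩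
  have h2 := tendsto_bpStep (J := J) (h := h) (abs_le_one_of_mem ⟨h0, h1⟩) hlim
  have h3 := hlim.comp (tendsto_add_atTop_nat 1)
  refine tendsto_nhds_unique h2 (h3.congr fun t => ?_)
  exact bpIter_succ t

lemma abs_le_one_of_mem_postFixpoints {ν : G.Dart → ℝ} (hν : ν ∈ postFixpoints G J h)
    (d : G.Dart) : |ν d| ≤ 1 :=
  abs_le.2 ⟨by have := hν.1 d; simp at this; linarith,
    (hν.2 d).trans (Real.tanh_lt_one _).le⟩

/-- The segment between comparable post-fixpoints consists of post-fixpoints. -/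
lemma segment_mem_postFixpoints (hJ : ∀ i j, G.Adj i j → 0 ≤ J i j) (hh : ∀ i, 0 ≤ h i)
    {ν μ : G.Dart → ℝ} (hν : ν ∈ postFixpoints G J h) (hμ : μ ∈ postFixpoints G J h)
    (hle : ν ≤ μ) {s : ℝ} (hs₀ : 0 ≤ s) (hs₁ : s ≤ 1) :
    (fun d => (1 - s) * ν d + s * μ d) ∈ postFixpoints G J h := by
  refine ⟨fun d => add_nonneg (mul_nonneg (by linarith) (hν.1 d)) (mul_nonneg hs₀ (hμ.1 d)),
    fun d => ?_⟩
  have key := segment_le_tanh_add_sum_artanh (hh d.fst) ((incoming G d.fst).erase d.symm)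
    (x := fun e => theta G J e * ν e) (y := fun e => theta G J e * μ e)
    (fun e _ => mul_nonneg (theta_nonneg hJ e) (hν.1 e))
    (fun e _ => mul_le_mul_of_nonneg_left (hle e) (theta_nonneg hJ e))
    (fun e _ => (abs_lt.1 (abs_theta_mul_lt_one e (abs_le_one_of_mem_postFixpoints hμ e))).2)
    hs₀ hs₁
  have h1 := mul_le_mul_of_nonneg_left (hν.2 d) (by linarith : 0 ≤ 1 - s)
  have h2 := mul_le_mul_of_nonneg_left (hμ.2 d) hs₀
  rw [bpStep_apply] at h1 h2
  rw [bpStep_apply]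
  have h3 : ∀ e : G.Dart, theta G J e * ((1 - s) * ν e + s * μ e) =
    (1 - s) * (theta G J e * ν e) + s * (theta G J e * μ e) := fun e => by ring
  simp only [h3]
  linarith

end dynamics

/-! ### Monotonicity of the dual Bethe free energy -/

lemma hasDerivAt_plusWeight {ι : Type*} [DecidableEq ι] (u : ℝ) (S : Finset ι) (x y : ι → ℝ)
    (s : ℝ) : HasDerivAt (fun s : ℝ => plusWeight u S (x + s • y))
      (∑ e ∈ S, plusWeight u (S.erase e) (x + s • y) * y e) s := by
  have h1 : ∀ e ∈ S, HasDerivAt (fun s : ℝ => 1 + (x + s • y) e) (y e) s := by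
    intro e _
    have := (((hasDerivAt_id s).mul_const (y e)).const_add (x e)).const_add 1
    simpa using this
  have h2 := (HasDerivAt.fun_finsetProd h1).const_mul (Real.exp u)
  refine h2.congr_deriv ?_
  rw [Finset.mul_sum]
  exact Finset.sum_congr rfl fun e _ => by rw [plusWeight, smul_eq_mul, mul_assoc]

/-- With $p,q$ the plus and minus weights without $e$, the derivative of the logarithm in $z_e$ is
$(p-q)/(p(1+z_e)+q(1-z_e))=T/(1+z_eT)$, where $T=(p-q)/(p+q)$ is the `tanh` of the field without
$e$. -/
lemma hasDerivAt_log_plusWeight_add {ι : Type*} [DecidableEq ι] (u : ℝ) (S : Finset ι)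
    (x y : ι → ℝ) (s : ℝ) (hx : ∀ e ∈ S, |(x + s • y) e| < 1) :
    HasDerivAt
      (fun s : ℝ => Real.log (plusWeight u S (x + s • y) + plusWeight (-u) S (-(x + s • y))))
      (∑ e ∈ S, y e *
        (Real.tanh (u + ∑ k ∈ S.erase e, Real.artanh ((x + s • y) k)) /
        (1 + (x + s • y) e * Real.tanh (u + ∑ k ∈ S.erase e, Real.artanh ((x + s • y) k))))) s := by
  have hp := plusWeight_pos u hx
  have hm := plusWeight_neg_pos u hx
  have hneg : ∀ s : ℝ, -x + s • -y = -(x + s • y) := fun s => by rw [neg_add, smul_neg]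
  have d2 := hasDerivAt_plusWeight (-u) S (-x) (-y) s
  simp only [hneg] at d2
  refine (((hasDerivAt_plusWeight u S x y s).fun_add d2).log (add_pos hp hm).ne').congr_deriv ?_
  rw [← Finset.sum_add_distrib, Finset.sum_div]
  refine Finset.sum_congr rfl fun e he => ?_
  generalize x + s • y = z at *
  have hz : ∀ k ∈ S.erase e, |z k| < 1 := fun k hk => hx k (Finset.mem_of_mem_erase hk)
  rw [tanh_add_sum_artanh u (S.erase e) z hz, plusWeight_erase u z he,
    plusWeight_erase (-u) (-z) he]
  have hp' := plusWeight_pos u hz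
  have hm' := plusWeight_neg_pos u hz
  obtain ⟨h1, h2⟩ := abs_lt.1 (hx e he)
  generalize plusWeight u (S.erase e) z = p at *
  generalize plusWeight (-u) (S.erase e) (-z) = q at *
  simp only [Pi.neg_apply]
  have h3 : 0 < p * (1 + z e) + q * (1 + -z e) :=
    add_pos (mul_pos hp' (by linarith)) (mul_pos hm' (by linarith))
  have h4 : 1 + z e * ((p - q) / (p + q)) = (p * (1 + z e) + q * (1 + -z e)) / (p + q) := by
    field_simp; ring
  rw [h4, div_div_div_cancel_right₀ (by positivity)]
  ring

section edgeSum

variable [Fintype V] [DecidableRel G.Adj]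

lemma sum_symm (f : G.Dart → ℝ) : ∑ d : G.Dart, f d.symm = ∑ d, f d :=
  Equiv.sum_comp (SimpleGraph.Dart.symm_involutive (G := G)).toPerm f

lemma edgeSum_add_symm (f : G.Dart → ℝ) : edgeSum G (fun d => f d + f d.symm) = ∑ d, f d := by
  rw [edgeSum, Finset.sum_add_distrib, sum_symm]; ring

lemma edgeSum_le_edgeSum {f g : G.Dart → ℝ} (hfg : ∀ d, f d ≤ g d) :
    edgeSum G f ≤ edgeSum G g :=
  mul_le_mul_of_nonneg_left (Finset.sum_le_sum fun d _ => hfg d) (by norm_num)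

lemma edgeSum_add (f g : G.Dart → ℝ) :
    edgeSum G (fun d => f d + g d) = edgeSum G f + edgeSum G g := by
  rw [edgeSum, edgeSum, edgeSum, Finset.sum_add_distrib, mul_add]

end edgeSum

section dual

variable [Fintype V] [DecidableEq V] [DecidableRel G.Adj]

lemma sum_incoming (f : G.Dart → ℝ) : ∑ i, ∑ e ∈ incoming G i, f e = ∑ e, f e :=
  Finset.sum_fiberwise Finset.univ (fun e : G.Dart => e.snd) f

lemma dualVertexTerm_eq (ν : G.Dart → ℝ) (i : V) :
    dualVertexTerm G J h ν i =
      Real.log (plusWeight (h i) (incoming G i) (theta G J * ν) +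
        plusWeight (-h i) (incoming G i) (-(theta G J * ν))) +
      ∑ e ∈ incoming G i, Real.log (Real.cosh (J e.fst e.snd)) := by
  rw [plusWeight_neg]; rfl

/-- The message on `d` enters one vertex term, that of its head, and one undirected edge term. In
the vertex derivative the field without `d` is the one that BP uses on `d.symm`, so the two
contributions differ only by the update of the opposite message. -/
lemma hasDerivAt_dualBetheFreeEnergy (hs : ∀ i j, G.Adj i j → J i j = J j i)
    (ν δ : G.Dart → ℝ) (s : ℝ) (hν : ∀ d, |(ν + s • δ) d| ≤ 1) :
    HasDerivAt (fun s : ℝ => dualBetheFreeEnergy G J h (ν + s • δ))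
      (∑ d, theta G J d * δ d *
        (bpStep G J h (ν + s • δ) d.symm /
            (1 + theta G J d * (ν + s • δ) d * bpStep G J h (ν + s • δ) d.symm) -
          (ν + s • δ) d.symm / (1 + theta G J d * (ν + s • δ) d * (ν + s • δ) d.symm))) s := by
  have hlin : ∀ s : ℝ, theta G J * (ν + s • δ) = theta G J * ν + s • (theta G J * δ) :=
    fun s => by rw [mul_add, mul_smul_comm]
  have hvert : ∀ i, HasDerivAt (fun s : ℝ => dualVertexTerm G J h (ν + s • δ) i)
      (∑ e ∈ incoming G i, theta G J e * δ e *
        (bpStep G J h (ν + s • δ) e.symm /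
          (1 + theta G J e * (ν + s • δ) e * bpStep G J h (ν + s • δ) e.symm))) s := by
    intro i
    simp only [dualVertexTerm_eq, hlin]
    refine ((hasDerivAt_log_plusWeight_add (h i) (incoming G i) (theta G J * ν)
      (theta G J * δ) s fun e _ => ?_).add_const _).congr_deriv ?_
    · rw [← hlin]
      exact abs_theta_mul_lt_one e (hν e)
    · refine Finset.sum_congr rfl fun e he => ?_
      obtain rfl := mem_incoming.1 he
      rw [bpStep_apply, ← hlin]
      rfl
  have hedge : ∀ d, HasDerivAt (fun s : ℝ => dualEdgeTerm G J (ν + s • δ) d)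
      (theta G J d * δ d *
          ((ν + s • δ) d.symm / (1 + theta G J d * (ν + s • δ) d * (ν + s • δ) d.symm)) +
        theta G J d.symm * δ d.symm * ((ν + s • δ) d.symm.symm /
          (1 + theta G J d.symm * (ν + s • δ) d.symm * (ν + s • δ) d.symm.symm))) s := by
    intro d
    have h1 : ∀ d, HasDerivAt (fun s : ℝ => (ν + s • δ) d) (δ d) s := by
      intro d
      have := ((hasDerivAt_id s).mul_const (δ d)).const_add (ν d)
      simpa using this
    have hpos : 0 < 1 + theta G J d * (ν + s • δ) d * (ν + s • δ) d.symm := by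
      have := abs_mul_lt_one (abs_theta_mul_lt_one (J := J) d (hν d)) (hν d.symm)
      linarith [(abs_lt.1 this).1]
    refine ((((((h1 d).const_mul (theta G J d)).fun_mul (h1 d.symm)).const_add 1).log
      hpos.ne').add_const _).congr_deriv ?_
    have h2 : 1 + theta G J d * (ν + s • δ) d.symm * (ν + s • δ) d =
      1 + theta G J d * (ν + s • δ) d * (ν + s • δ) d.symm := by ring
    rw [SimpleGraph.Dart.symm_symm, theta_symm hs, h2]
    ring
  have h1 := (HasDerivAt.fun_sum fun i (_ : i ∈ Finset.univ) => hvert i).sub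
    ((HasDerivAt.fun_sum fun d (_ : d ∈ Finset.univ) => hedge d).const_mul (1 / 2))
  refine h1.congr_deriv ?_
  rw [sum_incoming]
  have h2 := edgeSum_add_symm fun d : G.Dart => theta G J d * δ d *
    ((ν + s • δ) d.symm / (1 + theta G J d * (ν + s • δ) d * (ν + s • δ) d.symm))
  rw [edgeSum] at h2
  rw [h2, ← Finset.sum_sub_distrib]
  exact Finset.sum_congr rfl fun d _ => by ring

/-- The dual Bethe free energy increases along a segment if every message that moves is
opposite to a message that lies below its update. -/
lemma dualBetheFreeEnergy_le_of_segment (hs : ∀ i j, G.Adj i j → J i j = J j i)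
    (hJ : ∀ i j, G.Adj i j → 0 ≤ J i j) {ν δ : G.Dart → ℝ} (hδ : 0 ≤ δ)
    (hν : ∀ s ∈ Set.Icc (0 : ℝ) 1, ∀ d, |(ν + s • δ) d| ≤ 1)
    (hpost : ∀ s ∈ Set.Icc (0 : ℝ) 1, ∀ d, δ d ≠ 0 →
      (ν + s • δ) d.symm ≤ bpStep G J h (ν + s • δ) d.symm) :
    dualBetheFreeEnergy G J h ν ≤ dualBetheFreeEnergy G J h (ν + δ) := by
  have hderiv := fun s hs' => hasDerivAt_dualBetheFreeEnergy (h := h) hs ν δ s (hν s hs')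
  have hmono : MonotoneOn (fun s : ℝ => dualBetheFreeEnergy G J h (ν + s • δ))
      (Set.Icc 0 1) := by
    refine monotoneOn_of_deriv_nonneg (convex_Icc 0 1)
      (fun s hs' => (hderiv s hs').continuousAt.continuousWithinAt)
      (fun s hs' => (hderiv s (interior_subset hs')).differentiableAt.differentiableWithinAt)
      fun s hs' => ?_
    have hs1 := interior_subset hs'
    rw [(hderiv s hs1).deriv]
    refine Finset.sum_nonneg fun d _ => ?_
    by_cases hd : δ d = 0
    · simp [hd]
    refine mul_nonneg (mul_nonneg (theta_nonneg hJ d) (hδ d)) (sub_nonneg.2 ?_)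
    have hx := abs_theta_mul_lt_one (J := J) d (hν s hs1 d)
    have p1 := abs_mul_lt_one hx (hν s hs1 d.symm)
    have p2 := abs_mul_lt_one hx (abs_bpStep_lt_one (J := J) (h := h) (ν + s • δ) d.symm).le
    -- Monotonicity of $x/(1+cx)$: after cross-multiplication the terms in $c$ cancel.
    rw [div_le_div_iff₀ (by linarith [(abs_lt.1 p1).1]) (by linarith [(abs_lt.1 p2).1])]
    linarith [hpost s hs1 d hd]
  simpa using hmono (Set.left_mem_Icc.2 zero_le_one) (Set.right_mem_Icc.2 zero_le_one)
    zero_le_one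

lemma dualBetheFreeEnergy_le_of_mem_postFixpoints (hs : ∀ i j, G.Adj i j → J i j = J j i)
    (hJ : ∀ i j, G.Adj i j → 0 ≤ J i j) (hh : ∀ i, 0 ≤ h i) {ν μ : G.Dart → ℝ}
    (hν : ν ∈ postFixpoints G J h) (hμ : μ ∈ postFixpoints G J h) (hle : ν ≤ μ) :
    dualBetheFreeEnergy G J h ν ≤ dualBetheFreeEnergy G J h μ := by
  have hseg : ∀ s ∈ Set.Icc (0 : ℝ) 1, ν + s • (μ - ν) ∈ postFixpoints G J h := by
    intro s hs'
    have := segment_mem_postFixpoints hJ hh hν hμ hle hs'.1 hs'.2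
    convert this using 1
    ext d
    simp only [Pi.add_apply, Pi.smul_apply, Pi.sub_apply, smul_eq_mul]
    ring
  have := dualBetheFreeEnergy_le_of_segment (h := h) hs hJ (sub_nonneg.2 hle)
    (fun s hs' => abs_le_one_of_mem_postFixpoints (hseg s hs'))
    (fun s hs' d _ => (hseg s hs').2 d.symm)
  simpa using this

/-- Raising negative messages to zero, when no edge carries two negative messages. -/
lemma dualBetheFreeEnergy_le_sup_zero (hs : ∀ i j, G.Adj i j → J i j = J j i)
    (hJ : ∀ i j, G.Adj i j → 0 ≤ J i j) {ν : G.Dart → ℝ}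
    (hν : ∀ d, |ν d| ≤ 1) (hpost : ν ≤ bpStep G J h ν)
    (hpair : ∀ d, ν d < 0 → 0 ≤ ν d.symm) :
    dualBetheFreeEnergy G J h ν ≤ dualBetheFreeEnergy G J h (ν ⊔ 0) := by
  have hval : ∀ (s : ℝ) (d : G.Dart), (ν + s • (ν ⊔ 0 - ν)) d = ν d + s * (max (ν d) 0 - ν d) :=
    fun s d => rfl
  have hrange : ∀ s ∈ Set.Icc (0 : ℝ) 1, ∀ d, |(ν + s • (ν ⊔ 0 - ν)) d| ≤ 1 := by
    intro s hs' d
    rw [hval]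
    obtain ⟨h1, h2⟩ := abs_le.1 (hν d)
    rcases le_total (ν d) 0 with h3 | h3
    · rw [max_eq_right h3, abs_le]
      constructor <;> nlinarith [hs'.1, hs'.2]
    · rw [max_eq_left h3]; simpa using hν d
  have := dualBetheFreeEnergy_le_of_segment (h := h) (ν := ν) (δ := ν ⊔ 0 - ν) hs hJ
    (sub_nonneg.2 le_sup_left) hrange fun s hs' d hd => by
      have h1 : ν d < 0 := by
        by_contra h2
        exact hd (by simp [max_eq_left (not_lt.1 h2)])
      have h2 : ν ≤ ν + s • (ν ⊔ 0 - ν) :=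
        le_add_of_nonneg_right (smul_nonneg hs'.1 (sub_nonneg.2 le_sup_left))
      -- Only negative messages move. The message opposite to a moving one is nonnegative, so it
      -- stays put while its update can only grow.
      have h3 := bpStep_mono (h := h) hJ hν (hrange s hs') h2 d.symm
      rw [hval, max_eq_left (hpair d h1), sub_self, mul_zero, add_zero]
      exact (hpost _).trans h3
  simpa using this

lemma sup_zero_mem_postFixpoints (hJ : ∀ i j, G.Adj i j → 0 ≤ J i j) (hh : ∀ i, 0 ≤ h i)
    {ν : G.Dart → ℝ} (hν : ∀ d, |ν d| ≤ 1) (hpost : ν ≤ bpStep G J h ν) :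
    ν ⊔ 0 ∈ postFixpoints G J h := by
  have h1 : ∀ d, |(ν ⊔ 0) d| ≤ 1 := fun d => by
    rw [Pi.sup_apply, Pi.zero_apply, abs_of_nonneg le_sup_right]
    exact sup_le (abs_le.1 (hν d)).2 zero_le_one
  exact ⟨le_sup_right, sup_le (hpost.trans (bpStep_mono hJ hν h1 le_sup_left))
    (bpStep_nonneg hJ hh le_sup_right)⟩

end dual

/-! ### Entropies of spin distributions with given moments -/

/-- The law on `{±1}²` with means `a`, `b` and correlation `c`. -/
def pairLaw (a b c : ℝ) (x y : ℤˣ) : ℝ :=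
  (1 + a * spin x + b * spin y + c * (spin x * spin y)) / 4

/-- The law on `{±1}` with mean `a`. -/
def spinLaw (a : ℝ) (x : ℤˣ) : ℝ := (1 + a * spin x) / 2

/-- The entropy of the law on `{±1}²` with means `a`, `b` and correlation `c`. -/
def pairEntropy (a b c : ℝ) : ℝ := ∑ x, ∑ y, Real.negMulLog (pairLaw a b c x y)

/-- The entropy of the law on `{±1}` with mean `a`. -/
def spinEntropy (a : ℝ) : ℝ := ∑ x, Real.negMulLog (spinLaw a x)

/-- `E log (1 + u X)` for a spin `X` of mean `a`. -/
def spinLog (a u : ℝ) : ℝ := ∑ x, spinLaw a x * Real.log (1 + u * spin x)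

@[simp] lemma spin_one : spin 1 = 1 := by simp [spin]

@[simp] lemma spin_neg_one : spin (-1) = -1 := by simp [spin]

lemma spin_eq (x : ℤˣ) : spin x = 1 ∨ spin x = -1 := by
  rcases Int.units_eq_one_or x with rfl | rfl <;> simp

lemma sum_units (f : ℤˣ → ℝ) : ∑ x, f x = f 1 + f (-1) := by
  rw [UnitsInt.univ, Finset.sum_pair (by decide)]

lemma one_add_mul_spin_pos {u : ℝ} (hu : |u| < 1) (x : ℤˣ) : 0 < 1 + u * spin x := by
  obtain ⟨h1, h2⟩ := abs_lt.1 hu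
  rcases spin_eq x with h | h <;> rw [h] <;> linarith

lemma spinLaw_nonneg {a : ℝ} (ha : |a| ≤ 1) (x : ℤˣ) : 0 ≤ spinLaw a x := by
  obtain ⟨h1, h2⟩ := abs_le.1 ha
  rw [spinLaw]
  rcases spin_eq x with h | h <;> rw [h] <;> linarith

lemma sum_spinLaw (a : ℝ) : ∑ x, spinLaw a x = 1 := by
  simp [spinLaw]; ring

lemma sum_spinLaw_mul_spin (a : ℝ) : ∑ x, spinLaw a x * spin x = a := by
  simp [spinLaw]; ring

lemma sum_pairLaw_right (a b c : ℝ) (x : ℤˣ) : ∑ y, pairLaw a b c x y = spinLaw a x := by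
  simp [spinLaw, pairLaw]; ring

lemma sum_pairLaw_left (a b c : ℝ) (y : ℤˣ) : ∑ x, pairLaw a b c x y = spinLaw b y := by
  simp [spinLaw, pairLaw]; ring

lemma sum_pairLaw_mul_spin (a b c : ℝ) :
    ∑ x, ∑ y, pairLaw a b c x y * (spin x * spin y) = c := by
  simp [pairLaw]; ring

/-- Gibbs' inequality. -/
lemma sum_negMulLog_add_le {ι : Type*} [Fintype ι] {p w : ι → ℝ} (hp : ∀ x, 0 ≤ p x)
    (hp1 : ∑ x, p x = 1) (hw : ∀ x, 0 < w x) :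
    ∑ x, (Real.negMulLog (p x) + p x * Real.log (w x)) ≤ Real.log (∑ x, w x) := by
  have hne : (Finset.univ : Finset ι).Nonempty := by
    by_contra h
    rw [Finset.not_nonempty_iff_eq_empty.1 h] at hp1
    simp at hp1
  have hW : 0 < ∑ x, w x := Finset.sum_pos (fun x _ => hw x) hne
  have key : ∀ x, Real.negMulLog (p x) + p x * Real.log (w x) ≤
      p x * Real.log (∑ x, w x) + (w x / (∑ x, w x) - p x) := by
    intro x
    rcases (hp x).eq_or_lt with h0 | h0
    · simp [← h0, div_nonneg (hw x).le hW.le]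
    -- With $W=\sum w$, this is $\log y\le y-1$ at $y=w/(pW)$; the corrections $w/W-p$ sum to zero.
    · have h1 := Real.log_le_sub_one_of_pos
        (div_pos (hw x) (mul_pos h0 hW))
      rw [Real.log_div (hw x).ne' (mul_pos h0 hW).ne', Real.log_mul h0.ne' hW.ne'] at h1
      have h2 := mul_le_mul_of_nonneg_left h1 h0.le
      have h3 : p x * (w x / (p x * ∑ x, w x) - 1) = w x / (∑ x, w x) - p x := by
        field_simp
      rw [h3] at h2
      rw [Real.negMulLog]
      linarith
  calc _ ≤ ∑ x, (p x * Real.log (∑ x, w x) + (w x / (∑ x, w x) - p x)) :=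
        Finset.sum_le_sum fun x _ => key x
    _ = Real.log (∑ x, w x) := by
        rw [Finset.sum_add_distrib, ← Finset.sum_mul, Finset.sum_sub_distrib, ← Finset.sum_div,
          div_self hW.ne', hp1]
        ring

lemma sum_negMulLog_add_eq {ι : Type*} [Fintype ι] {p w : ι → ℝ}
    (hp1 : ∑ x, p x = 1) (hw : ∀ x, 0 < w x) (hpw : ∀ x, p x = w x / ∑ x, w x) :
    ∑ x, (Real.negMulLog (p x) + p x * Real.log (w x)) = Real.log (∑ x, w x) := by
  have hne : ∑ x, w x ≠ 0 := by
    intro h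
    simp [hpw, h] at hp1
  have key : ∀ x, Real.negMulLog (p x) + p x * Real.log (w x) =
      p x * Real.log (∑ x, w x) := by
    intro x
    have : Real.log (p x) = Real.log (w x) - Real.log (∑ x, w x) := by
      rw [hpw x, Real.log_div (hw x).ne' hne]
    rw [Real.negMulLog, this]; ring
  rw [Finset.sum_congr rfl fun x _ => key x, ← Finset.sum_mul, hp1, one_mul]

/-- The moments of the edge law `∝ e^{J x y} (1 + u x) (1 + v y)`, where `t = tanh J`. -/
def edgeMean (t u v : ℝ) : ℝ := (u + t * v) / (1 + t * u * v)

/-- The correlation of the edge law `∝ e^{J x y} (1 + u x) (1 + v y)`, where `t = tanh J`. -/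
def edgeCov (t u v : ℝ) : ℝ := (t + u * v) / (1 + t * u * v)

/-- The weight `e^{J x y} (1 + u x) (1 + v y)`. -/
def pairWeight (J u v : ℝ) (x y : ℤˣ) : ℝ :=
  Real.exp (J * (spin x * spin y)) * (1 + u * spin x) * (1 + v * spin y)

lemma one_add_mul_pos {t u v : ℝ} (ht : |t| < 1) (hu : |u| ≤ 1) (hv : |v| ≤ 1) :
    0 < 1 + t * u * v := by
  linarith [(abs_lt.1 (abs_mul_lt_one (abs_mul_lt_one ht hu) hv)).1]

lemma exp_mul_spin_mul_spin (J : ℝ) (x y : ℤˣ) :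
    Real.exp (J * (spin x * spin y)) = Real.cosh J * (1 + Real.tanh J * (spin x * spin y)) := by
  have h := (Real.cosh_pos J).ne'
  have h1 : Real.cosh J * (1 + Real.tanh J * (spin x * spin y)) =
      Real.cosh J + Real.sinh J * (spin x * spin y) := by
    rw [Real.tanh_eq_sinh_div_cosh]; field_simp
  rw [h1]
  rcases spin_eq x with hx | hx <;> rcases spin_eq y with hy | hy <;> rw [hx, hy] <;>
    simp [Real.cosh_add_sinh, Real.cosh_sub_sinh, ← sub_eq_add_neg]

lemma sum_pairWeight (J u v : ℝ) :
    ∑ x, ∑ y, pairWeight J u v x y = 4 * Real.cosh J * (1 + Real.tanh J * u * v) := by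
  simp only [pairWeight, exp_mul_spin_mul_spin, sum_units, spin_one, spin_neg_one]
  ring

lemma pairWeight_pos {J u v : ℝ} (hu : |u| < 1) (hv : |v| < 1) (x y : ℤˣ) :
    0 < pairWeight J u v x y :=
  mul_pos (mul_pos (Real.exp_pos _) (one_add_mul_spin_pos hu x)) (one_add_mul_spin_pos hv y)

lemma pairWeight_div_sum {J u v : ℝ} (hu : |u| ≤ 1) (hv : |v| ≤ 1) (x y : ℤˣ) :
    pairWeight J u v x y / ∑ x, ∑ y, pairWeight J u v x y =
      pairLaw (edgeMean (Real.tanh J) u v) (edgeMean (Real.tanh J) v u)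
        (edgeCov (Real.tanh J) u v) x y := by
  have h1 := one_add_mul_pos (Real.abs_tanh_lt_one J) hu hv
  have h2 := Real.cosh_pos J
  have h3 : 1 + Real.tanh J * v * u = 1 + Real.tanh J * u * v := by ring
  rw [sum_pairWeight, pairWeight, pairLaw, edgeMean, edgeMean, edgeCov, exp_mul_spin_mul_spin, h3]
  field_simp
  rcases spin_eq x with hx | hx <;> rcases spin_eq y with hy | hy <;> rw [hx, hy] <;> ring

lemma spinLaw_edgeMean {t u v : ℝ} (ht : |t| < 1) (hu : |u| ≤ 1) (hv : |v| ≤ 1) (x : ℤˣ) :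
    spinLaw (edgeMean t u v) x =
      (1 + u * spin x) * (1 + t * v * spin x) / (2 * (1 + t * u * v)) := by
  have h1 := one_add_mul_pos ht hu hv
  have h2 : edgeMean t u v * (1 + t * u * v) = u + t * v := div_mul_cancel₀ _ h1.ne'
  rw [spinLaw, div_eq_div_iff two_ne_zero (by positivity)]
  rcases spin_eq x with hx | hx <;> rw [hx]
  · linear_combination 2 * h2
  · linear_combination -2 * h2

/-- The marginal of the edge law is proportional to $(1+ux)(1+tvx)$, so its entropy splits into the
averages of the two logarithms and the normalization. -/
lemma spinEntropy_edgeMean {t u v : ℝ} (ht : |t| < 1) (hu : |u| < 1) (hv : |v| ≤ 1) :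
    spinEntropy (edgeMean t u v) = Real.log (2 * (1 + t * u * v)) -
      spinLog (edgeMean t u v) u - spinLog (edgeMean t u v) (t * v) := by
  have h1 := one_add_mul_pos ht hu.le hv
  have key : ∀ x, Real.negMulLog (spinLaw (edgeMean t u v) x) =
      spinLaw (edgeMean t u v) x * Real.log (2 * (1 + t * u * v)) -
      spinLaw (edgeMean t u v) x * Real.log (1 + u * spin x) -
      spinLaw (edgeMean t u v) x * Real.log (1 + t * v * spin x) := by
    intro x
    have h2 := one_add_mul_spin_pos hu x
    have h3 := one_add_mul_spin_pos (abs_mul_lt_one ht hv) x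
    have h4 : Real.log (spinLaw (edgeMean t u v) x) = Real.log (1 + u * spin x) +
        Real.log (1 + t * v * spin x) - Real.log (2 * (1 + t * u * v)) := by
      rw [spinLaw_edgeMean ht hu.le hv, Real.log_div (by positivity) (by positivity),
        Real.log_mul h2.ne' h3.ne']
    rw [Real.negMulLog, h4]; ring
  rw [spinEntropy, Finset.sum_congr rfl fun x _ => key x, Finset.sum_sub_distrib,
    Finset.sum_sub_distrib, ← Finset.sum_mul, sum_spinLaw, one_mul]
  rfl

lemma sum_pairLaw_mul_log (a b c J : ℝ) {u v : ℝ} (hu : |u| < 1) (hv : |v| < 1) :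
    ∑ x, ∑ y, pairLaw a b c x y * Real.log (pairWeight J u v x y) =
      J * c + spinLog a u + spinLog b v := by
  have key : ∀ x y, pairLaw a b c x y * Real.log (pairWeight J u v x y) =
      J * (pairLaw a b c x y * (spin x * spin y)) +
      pairLaw a b c x y * Real.log (1 + u * spin x) +
      pairLaw a b c x y * Real.log (1 + v * spin y) := by
    intro x y
    have h2 := one_add_mul_spin_pos hu x
    have h3 := one_add_mul_spin_pos hv y
    rw [pairWeight, Real.log_mul (by positivity) h3.ne', Real.log_mul (by positivity) h2.ne',
      Real.log_exp]
    ring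
  simp only [key, Finset.sum_add_distrib, ← Finset.mul_sum, sum_pairLaw_mul_spin]
  congr 1
  · congr 1
    refine Finset.sum_congr rfl fun x _ => ?_
    rw [← Finset.sum_mul, sum_pairLaw_right]
  · rw [Finset.sum_comm]
    refine Finset.sum_congr rfl fun y _ => ?_
    rw [← Finset.sum_mul, sum_pairLaw_left]

/-- The value at the edge law `∝ e^{J x y} (1 + u x) (1 + v y)` of energy plus entropy. -/
def edgeBound (J a b u v : ℝ) : ℝ :=
  Real.log (Real.cosh J) - Real.log (1 + Real.tanh J * u * v) +
    (spinEntropy a + spinLog a (Real.tanh J * v) + (spinEntropy b + spinLog b (Real.tanh J * u)))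

/-- Trades the messages sent along the edge for those received: `spinEntropy_edgeMean` replaces `-
spinLog a u` by `spinEntropy a + spinLog a (t * v)` up to normalization. The received form is what
the vertex terms collect. -/
lemma log_sum_pairWeight {J u v : ℝ} (hu : |u| < 1) (hv : |v| < 1) :
    Real.log (∑ x, ∑ y, pairWeight J u v x y) -
      spinLog (edgeMean (Real.tanh J) u v) u - spinLog (edgeMean (Real.tanh J) v u) v =
    edgeBound J (edgeMean (Real.tanh J) u v) (edgeMean (Real.tanh J) v u) u v := by
  have ht := Real.abs_tanh_lt_one J
  have h1 := one_add_mul_pos ht hu.le hv.le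
  have h2 := Real.cosh_pos J
  have h3 : 1 + Real.tanh J * v * u = 1 + Real.tanh J * u * v := by ring
  have h4 : (4 : ℝ) = 2 * 2 := by norm_num
  rw [edgeBound, spinEntropy_edgeMean ht hu hv.le, spinEntropy_edgeMean ht hv hu.le,
    sum_pairWeight, h3, h4, Real.log_mul (by positivity) h1.ne',
    Real.log_mul (by positivity) h2.ne', Real.log_mul (by positivity) (by positivity),
    Real.log_mul (by positivity) h1.ne']
  ring

/-- Gibbs' inequality against `pairWeight`. For fixed means the single-spin logarithms are fixed, so
the bound is free of `c`; `pairEntropy_eq_edgeBound` shows that the law given by the messages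
attains it. -/
lemma pairEntropy_le_edgeBound {J u v c : ℝ} (hu : |u| < 1) (hv : |v| < 1)
    (hc : ∀ x y, 0 ≤ pairLaw (edgeMean (Real.tanh J) u v) (edgeMean (Real.tanh J) v u) c x y) :
    J * c + pairEntropy (edgeMean (Real.tanh J) u v) (edgeMean (Real.tanh J) v u) c ≤
      edgeBound J (edgeMean (Real.tanh J) u v) (edgeMean (Real.tanh J) v u) u v := by
  rw [← log_sum_pairWeight hu hv]
  have h1 := sum_negMulLog_add_le (ι := ℤˣ × ℤˣ)
    (p := fun z => pairLaw (edgeMean (Real.tanh J) u v) (edgeMean (Real.tanh J) v u) c z.1 z.2)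
    (w := fun z => pairWeight J u v z.1 z.2) (fun z => hc z.1 z.2)
    (by simp only [Fintype.sum_prod_type, sum_pairLaw_right, sum_spinLaw])
    (fun z => pairWeight_pos hu hv z.1 z.2)
  simp only [Fintype.sum_prod_type, Finset.sum_add_distrib,
    sum_pairLaw_mul_log _ _ _ _ hu hv] at h1
  rw [pairEntropy]
  linarith

lemma pairEntropy_eq_edgeBound {J u v : ℝ} (hu : |u| < 1) (hv : |v| < 1) :
    J * edgeCov (Real.tanh J) u v + pairEntropy (edgeMean (Real.tanh J) u v)
        (edgeMean (Real.tanh J) v u) (edgeCov (Real.tanh J) u v) =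
      edgeBound J (edgeMean (Real.tanh J) u v) (edgeMean (Real.tanh J) v u) u v := by
  rw [← log_sum_pairWeight hu hv]
  have h1 := sum_negMulLog_add_eq (ι := ℤˣ × ℤˣ)
    (p := fun z => pairLaw (edgeMean (Real.tanh J) u v) (edgeMean (Real.tanh J) v u)
      (edgeCov (Real.tanh J) u v) z.1 z.2)
    (w := fun z => pairWeight J u v z.1 z.2)
    (by simp only [Fintype.sum_prod_type, sum_pairLaw_right, sum_spinLaw])
    (fun z => pairWeight_pos hu hv z.1 z.2)
    (fun z => by simp only [Fintype.sum_prod_type, pairWeight_div_sum hu.le hv.le])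
  simp only [Fintype.sum_prod_type, Finset.sum_add_distrib,
    sum_pairLaw_mul_log _ _ _ _ hu hv] at h1
  rw [pairEntropy]
  linarith

/-- The weight `e^{u x} ∏ (1 + x z_e)` of a spin `x`. -/
def spinWeight {ι : Type*} (u : ℝ) (S : Finset ι) (z : ι → ℝ) (x : ℤˣ) : ℝ :=
  plusWeight (u * spin x) S fun e => z e * spin x

lemma spinWeight_pos {ι : Type*} (u : ℝ) {S : Finset ι} {z : ι → ℝ}
    (hz : ∀ e ∈ S, |z e| < 1) (x : ℤˣ) : 0 < spinWeight u S z x := by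
  refine plusWeight_pos _ fun e he => ?_
  rcases spin_eq x with hx | hx <;> simpa [hx] using hz e he

lemma sum_spinWeight {ι : Type*} (u : ℝ) (S : Finset ι) (z : ι → ℝ) :
    ∑ x, spinWeight u S z x = plusWeight u S z + plusWeight (-u) S (-z) := by
  simp [spinWeight, plusWeight]

lemma sum_spinLaw_mul_log {ι : Type*} (a u : ℝ) {S : Finset ι} {z : ι → ℝ}
    (hz : ∀ e ∈ S, |z e| < 1) :
    ∑ x, spinLaw a x * Real.log (spinWeight u S z x) = u * a + ∑ e ∈ S, spinLog a (z e) := by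
  have key : ∀ x, spinLaw a x * Real.log (spinWeight u S z x) =
      u * (spinLaw a x * spin x) + ∑ e ∈ S, spinLaw a x * Real.log (1 + z e * spin x) := by
    intro x
    have h1 : ∀ e ∈ S, 1 + z e * spin x ≠ 0 := fun e he => (one_add_mul_spin_pos (hz e he) x).ne'
    rw [spinWeight, plusWeight, Real.log_mul (Real.exp_pos _).ne' (Finset.prod_ne_zero_iff.2 h1),
      Real.log_exp, Real.log_prod h1, mul_add,
      Finset.mul_sum]
    ring
  simp only [key]
  rw [Finset.sum_add_distrib, ← Finset.mul_sum, sum_spinLaw_mul_spin, Finset.sum_comm]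
  rfl

lemma spinEntropy_add_le {ι : Type*} {a : ℝ} (ha : |a| ≤ 1) (u : ℝ) {S : Finset ι} {z : ι → ℝ}
    (hz : ∀ e ∈ S, |z e| < 1) :
    spinEntropy a + u * a + ∑ e ∈ S, spinLog a (z e) ≤
      Real.log (plusWeight u S z + plusWeight (-u) S (-z)) := by
  have h1 := sum_negMulLog_add_le (spinLaw_nonneg ha) (sum_spinLaw a) (spinWeight_pos u hz)
  rw [Finset.sum_add_distrib, sum_spinLaw_mul_log a u hz, sum_spinWeight] at h1
  rw [spinEntropy]
  linarith

lemma spinEntropy_add_eq {ι : Type*} {a : ℝ} (u : ℝ) {S : Finset ι} {z : ι → ℝ}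
    (hz : ∀ e ∈ S, |z e| < 1) (ha : a = Real.tanh (u + ∑ e ∈ S, Real.artanh (z e))) :
    spinEntropy a + u * a + ∑ e ∈ S, spinLog a (z e) =
      Real.log (plusWeight u S z + plusWeight (-u) S (-z)) := by
  have h0 : ∀ x, spinLaw a x = spinWeight u S z x / ∑ x, spinWeight u S z x := by
    intro x
    have hp := plusWeight_pos u hz
    have hm := plusWeight_neg_pos u hz
    rw [sum_spinWeight, ha, tanh_add_sum_artanh u S z hz, spinLaw]
    rcases Int.units_eq_one_or x with rfl | rfl
    · have : spinWeight u S z 1 = plusWeight u S z := by simp [spinWeight]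
      rw [this, spin_one]; field_simp; ring
    · have : spinWeight u S z (-1) = plusWeight (-u) S (-z) := by simp [spinWeight, plusWeight]
      rw [this, spin_neg_one]; field_simp; ring
  have h1 := sum_negMulLog_add_eq (sum_spinLaw a) (spinWeight_pos u hz) h0
  rw [Finset.sum_add_distrib, sum_spinLaw_mul_log a u hz, sum_spinWeight] at h1
  rw [spinEntropy]
  linarith

/-! ### Locally consistent distributions through their moments -/

lemma fst_symm (d : G.Dart) : d.symm.fst = d.snd := rfl

lemma snd_symm (d : G.Dart) : d.symm.snd = d.fst := rfl

/-- The candidate marginals with node means `m` and edge correlations `c`. -/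
def ofMoments (G : SimpleGraph V) (m : V → ℝ) (c : G.Dart → ℝ) : Marginals G where
  node i x := spinLaw (m i) x
  edge d x y := pairLaw (m d.fst) (m d.snd) (c d) x y

/-- The functions $1,x,y,xy$ form a basis of the functions on $\{\pm1\}^2$, and local consistency
fixes the normalization and the means on each edge. -/
lemma eq_ofMoments {P : Marginals G} (hP : IsLocallyConsistent G P) :
    P = ofMoments G (nodeMean P) (edgeCorr P) := by
  obtain ⟨node, edge⟩ := P
  rw [ofMoments, Marginals.mk.injEq]
  have hsum : ∀ i, node i 1 + node i (-1) = 1 := fun i => by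
    simpa [sum_units] using hP.node_sum i
  have hmean : ∀ i, nodeMean ⟨node, edge⟩ i = node i 1 - node i (-1) := fun i => by
    simp [nodeMean, sub_eq_add_neg]
  constructor
  · ext i x
    rw [spinLaw, hmean]
    have := hsum i
    rcases Int.units_eq_one_or x with rfl | rfl <;> simp only [spin_one, spin_neg_one] <;>
      linarith
  · ext d x y
    have h1 : ∀ y, edge d 1 y + edge d (-1) y = node d.snd y := fun y => by
      simpa [sum_units] using hP.edge_marginal d y
    have h2 : ∀ x, edge d x 1 + edge d x (-1) = node d.fst x := fun x => by
      have h3 := hP.edge_marginal d.symm x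
      simp only [sum_units, snd_symm] at h3
      have h4 : ∀ y, edge d.symm y x = edge d x y := fun y => hP.edge_symm d x y
      rwa [h4, h4] at h3
    have hc : edgeCorr ⟨node, edge⟩ d =
        edge d 1 1 - edge d 1 (-1) - edge d (-1) 1 + edge d (-1) (-1) := by
      simp only [edgeCorr, sum_units, spin_one, spin_neg_one]; ring
    rw [pairLaw, hmean, hmean, hc]
    have := hsum d.fst
    have := hsum d.snd
    have := h1 1
    have := h1 (-1)
    have := h2 1
    have := h2 (-1)
    rcases Int.units_eq_one_or x with rfl | rfl <;> rcases Int.units_eq_one_or y with rfl | rfl <;>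
      simp only [spin_one, spin_neg_one] <;> linarith

lemma isLocallyConsistent_ofMoments {m : V → ℝ} {c : G.Dart → ℝ} (hm : ∀ i, |m i| ≤ 1)
    (hc : ∀ d, c d.symm = c d) (hp : ∀ d x y, 0 ≤ pairLaw (m d.fst) (m d.snd) (c d) x y) :
    IsLocallyConsistent G (ofMoments G m c) where
  node_nonneg i x := spinLaw_nonneg (hm i) x
  node_sum i := sum_spinLaw _
  edge_nonneg := hp
  edge_symm d x y := by simp only [ofMoments, pairLaw, hc, fst_symm, snd_symm]; ring
  edge_marginal d y := sum_pairLaw_left _ _ _ _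

lemma abs_le_one_of_spinLaw_nonneg {a : ℝ} (h : ∀ x, 0 ≤ spinLaw a x) : |a| ≤ 1 := by
  have h1 := h 1
  have h2 := h (-1)
  simp only [spinLaw, spin_one, spin_neg_one] at h1 h2
  exact abs_le.2 ⟨by linarith, by linarith⟩

lemma abs_le_one_of_isLocallyConsistent {m : V → ℝ} {c : G.Dart → ℝ}
    (hP : IsLocallyConsistent G (ofMoments G m c)) (i : V) : |m i| ≤ 1 :=
  abs_le_one_of_spinLaw_nonneg (hP.node_nonneg i)

lemma nodeMean_ofMoments (m : V → ℝ) (c : G.Dart → ℝ) (i : V) :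
    nodeMean (ofMoments G m c) i = m i :=
  sum_spinLaw_mul_spin _

lemma edgeCorr_ofMoments (m : V → ℝ) (c : G.Dart → ℝ) (d : G.Dart) :
    edgeCorr (ofMoments G m c) d = c d :=
  sum_pairLaw_mul_spin _ _ _

lemma corr_symm_of_isLocallyConsistent {m : V → ℝ} {c : G.Dart → ℝ}
    (hP : IsLocallyConsistent G (ofMoments G m c)) (d : G.Dart) : c d.symm = c d := by
  rw [← edgeCorr_ofMoments m c d.symm, ← edgeCorr_ofMoments m c d, edgeCorr, Finset.sum_comm,
    edgeCorr]
  refine Finset.sum_congr rfl fun x _ => Finset.sum_congr rfl fun y _ => ?_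
  rw [hP.edge_symm, mul_comm (spin y)]

/-- The messages `ν` reproduce the node means `m` on every edge. -/
def MatchesMeans (G : SimpleGraph V) (J : V → V → ℝ) (m : V → ℝ) (ν : G.Dart → ℝ) : Prop :=
  ∀ d : G.Dart, m d.fst = edgeMean (theta G J d) (ν d) (ν d.symm)

/-- The edge correlations that correspond to the messages `ν`. -/
def messageCorr (G : SimpleGraph V) (J : V → V → ℝ) (ν : G.Dart → ℝ) (d : G.Dart) : ℝ :=
  edgeCov (theta G J d) (ν d) (ν d.symm)

lemma MatchesMeans.snd (hs : ∀ i j, G.Adj i j → J i j = J j i) {m : V → ℝ} {ν : G.Dart → ℝ}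
    (hm : MatchesMeans G J m ν) (d : G.Dart) :
    m d.snd = edgeMean (theta G J d) (ν d.symm) (ν d) := by
  simpa [theta_symm hs] using hm d.symm

lemma messageCorr_symm (hs : ∀ i j, G.Adj i j → J i j = J j i) (ν : G.Dart → ℝ) (d : G.Dart) :
    messageCorr G J ν d.symm = messageCorr G J ν d := by
  rw [messageCorr, messageCorr, edgeCov, edgeCov, theta_symm hs, SimpleGraph.Dart.symm_symm,
    mul_comm (ν d.symm), mul_right_comm]

lemma pairLaw_messageCorr (hs : ∀ i j, G.Adj i j → J i j = J j i) {m : V → ℝ}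
    {ν : G.Dart → ℝ} (hm : MatchesMeans G J m ν) (hν : ∀ d, |ν d| ≤ 1) (d : G.Dart) (x y : ℤˣ) :
    pairLaw (m d.fst) (m d.snd) (messageCorr G J ν d) x y =
      pairWeight (J d.fst d.snd) (ν d) (ν d.symm) x y /
        ∑ x, ∑ y, pairWeight (J d.fst d.snd) (ν d) (ν d.symm) x y := by
  rw [pairWeight_div_sum (hν d) (hν d.symm), hm d, hm.snd hs d]
  rfl

lemma pairLaw_messageCorr_pos (hs : ∀ i j, G.Adj i j → J i j = J j i) {m : V → ℝ}
    {ν : G.Dart → ℝ} (hm : MatchesMeans G J m ν) (hν : ∀ d, |ν d| < 1) (d : G.Dart) (x y : ℤˣ) :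
    0 < pairLaw (m d.fst) (m d.snd) (messageCorr G J ν d) x y := by
  rw [pairLaw_messageCorr hs hm fun d => (hν d).le]
  exact div_pos (pairWeight_pos (hν _) (hν _) x y)
    (Finset.sum_pos (fun x _ => Finset.sum_pos (fun y _ => pairWeight_pos (hν _) (hν _) x y)
      Finset.univ_nonempty) Finset.univ_nonempty)

lemma betheFreeEnergy_ofMoments [Fintype V] [DecidableRel G.Adj] (m : V → ℝ) (c : G.Dart → ℝ) :
    betheFreeEnergy G J h (ofMoments G m c) =
      edgeSum G (fun d => J d.fst d.snd * c d + pairEntropy (m d.fst) (m d.snd) (c d)) +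
        ∑ i, h i * m i - ∑ i, ((G.degree i : ℝ) - 1) * spinEntropy (m i) := by
  rw [betheFreeEnergy, edgeSum_add]
  simp only [nodeMean_ofMoments, edgeCorr_ofMoments]
  rw [add_right_comm]
  rfl

section bethe

variable [Fintype V] [DecidableEq V] [DecidableRel G.Adj]

lemma card_incoming (i : V) : (incoming G i).card = G.degree i := by
  rw [← SimpleGraph.dart_fst_fiber_card_eq_degree]
  exact Finset.card_nbij' SimpleGraph.Dart.symm SimpleGraph.Dart.symm
    (by intro d; simp [incoming]) (by intro d; simp [incoming]) (by intro d; simp)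
    (by intro d; simp)

/-- Each edge bound splits into two directed halves, which are collected at their heads. Vertex `i`
receives `deg i` copies of its entropy, and the Bethe correction leaves exactly one. -/
lemma edgeSum_edgeBound (hs : ∀ i j, G.Adj i j → J i j = J j i) (m : V → ℝ) (ν : G.Dart → ℝ) :
    edgeSum G (fun d => edgeBound (J d.fst d.snd) (m d.fst) (m d.snd) (ν d) (ν d.symm)) +
        ∑ i, h i * m i - ∑ i, ((G.degree i : ℝ) - 1) * spinEntropy (m i) =
      ∑ i, (spinEntropy (m i) + h i * m i +
          ∑ e ∈ incoming G i, spinLog (m i) (theta G J e * ν e) +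
          ∑ e ∈ incoming G i, Real.log (Real.cosh (J e.fst e.snd))) -
        edgeSum G (dualEdgeTerm G J ν) := by
  -- The term `log cosh J` occurs once per direction; the second copy balances the one in
  -- `dualEdgeTerm`.
  set f : G.Dart → ℝ := fun d => Real.log (Real.cosh (J d.fst d.snd)) +
    (spinEntropy (m d.snd) + spinLog (m d.snd) (theta G J d * ν d)) with hf
  have h1 : edgeSum G (fun d => edgeBound (J d.fst d.snd) (m d.fst) (m d.snd) (ν d) (ν d.symm)) =
      ∑ d, f d - edgeSum G (dualEdgeTerm G J ν) := by
    rw [eq_sub_iff_add_eq, ← edgeSum_add, ← edgeSum_add_symm]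
    congr 1
    ext d
    have := hs _ _ d.adj
    simp only [edgeBound, dualEdgeTerm, hf, fst_symm, snd_symm,
      theta_symm hs, ← this]
    simp only [theta]
    ring
  have h2 : ∑ d, f d = ∑ i, ((G.degree i : ℝ) * spinEntropy (m i) +
      ∑ e ∈ incoming G i, spinLog (m i) (theta G J e * ν e) +
      ∑ e ∈ incoming G i, Real.log (Real.cosh (J e.fst e.snd))) := by
    rw [← sum_incoming]
    refine Finset.sum_congr rfl fun i _ => ?_
    have : ∀ e ∈ incoming G i, f e = spinEntropy (m i) + spinLog (m i) (theta G J e * ν e) +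
        Real.log (Real.cosh (J e.fst e.snd)) := by
      intro e he
      simp only [hf, mem_incoming.1 he]; ring
    rw [Finset.sum_congr rfl this, Finset.sum_add_distrib, Finset.sum_add_distrib,
      Finset.sum_const, card_incoming, nsmul_eq_mul]
  rw [h1, h2]
  simp only [Finset.sum_add_distrib, sub_mul, Finset.sum_sub_distrib, one_mul]
  ring

lemma betheFreeEnergy_le_messageCorr (hs : ∀ i j, G.Adj i j → J i j = J j i) {m : V → ℝ}
    {c ν : G.Dart → ℝ} (hm : MatchesMeans G J m ν) (hν : ∀ d, |ν d| < 1)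
    (hP : IsLocallyConsistent G (ofMoments G m c)) :
    betheFreeEnergy G J h (ofMoments G m c) ≤
      betheFreeEnergy G J h (ofMoments G m (messageCorr G J ν)) := by
  rw [betheFreeEnergy_ofMoments, betheFreeEnergy_ofMoments]
  have : ∀ d : G.Dart, J d.fst d.snd * c d + pairEntropy (m d.fst) (m d.snd) (c d) ≤
      J d.fst d.snd * messageCorr G J ν d +
        pairEntropy (m d.fst) (m d.snd) (messageCorr G J ν d) := by
    intro d
    have h1 := hP.edge_nonneg d
    simp only [ofMoments] at h1
    rw [hm d, hm.snd hs d] at h1 ⊢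
    exact (pairEntropy_le_edgeBound (hν d) (hν d.symm) h1).trans_eq
      (pairEntropy_eq_edgeBound (hν d) (hν d.symm)).symm
  linarith [edgeSum_le_edgeSum this]

lemma betheFreeEnergy_messageCorr (hs : ∀ i j, G.Adj i j → J i j = J j i) {m : V → ℝ}
    {ν : G.Dart → ℝ} (hm : MatchesMeans G J m ν) (hν : ∀ d, |ν d| < 1) :
    betheFreeEnergy G J h (ofMoments G m (messageCorr G J ν)) =
      ∑ i, (spinEntropy (m i) + h i * m i +
          ∑ e ∈ incoming G i, spinLog (m i) (theta G J e * ν e) +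
          ∑ e ∈ incoming G i, Real.log (Real.cosh (J e.fst e.snd))) -
        edgeSum G (dualEdgeTerm G J ν) := by
  rw [betheFreeEnergy_ofMoments, ← edgeSum_edgeBound hs]
  congr 3
  ext d
  rw [hm d, hm.snd hs d]
  exact pairEntropy_eq_edgeBound (hν d) (hν d.symm)

lemma betheFreeEnergy_le_dual (hs : ∀ i j, G.Adj i j → J i j = J j i) {m : V → ℝ}
    {c ν : G.Dart → ℝ} (hm : MatchesMeans G J m ν) (hν : ∀ d, |ν d| < 1)
    (hP : IsLocallyConsistent G (ofMoments G m c)) :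
    betheFreeEnergy G J h (ofMoments G m c) ≤ dualBetheFreeEnergy G J h ν := by
  refine (betheFreeEnergy_le_messageCorr hs hm hν hP).trans ?_
  rw [betheFreeEnergy_messageCorr hs hm hν, dualBetheFreeEnergy]
  refine sub_le_sub_right (Finset.sum_le_sum fun i _ => ?_) _
  rw [dualVertexTerm_eq]
  exact add_le_add_left (spinEntropy_add_le (abs_le_one_of_isLocallyConsistent hP i) (h i)
    fun e _ => abs_theta_mul_lt_one e (hν e).le) _

/-! ### The beliefs of a fixed point -/

/-- Splitting the contribution of `d.symm` off the full field at `d.fst` leaves the BP update on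
`d`, which is `ν d` at a fixed point. -/
lemma matchesMeans_bpMean (hs : ∀ i j, G.Adj i j → J i j = J j i) {ν : G.Dart → ℝ}
    (hν : ∀ d, |ν d| ≤ 1) (hfix : bpStep G J h ν = ν) :
    MatchesMeans G J (bpMean G J h ν) ν := by
  intro d
  have h1 : bpMean G J h ν d.fst = Real.tanh ((h d.fst +
      ∑ e ∈ (incoming G d.fst).erase d.symm, Real.artanh (theta G J e * ν e)) +
        Real.artanh (theta G J d.symm * ν d.symm)) := by
    rw [bpMean, add_assoc, Finset.sum_erase_add _ _ (symm_mem_incoming d)]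
  have h2 := congrFun hfix d
  rw [bpStep_apply] at h2
  rw [h1, tanh_add_artanh _ (abs_theta_mul_lt_one _ (hν _)), h2, theta_symm hs, edgeMean]
  congr 2
  ring

lemma beliefs_eq_ofMoments (hs : ∀ i j, G.Adj i j → J i j = J j i) {ν : G.Dart → ℝ}
    (hν : ∀ d, |ν d| ≤ 1) (hfix : bpStep G J h ν = ν) :
    beliefs G J h ν = ofMoments G (bpMean G J h ν) (messageCorr G J ν) := by
  rw [beliefs, ofMoments, Marginals.mk.injEq]
  refine ⟨rfl, ?_⟩
  ext d x y
  rw [pairLaw_messageCorr hs (matchesMeans_bpMean hs hν hfix) hν]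
  rfl

lemma abs_lt_one_of_fixed {ν : G.Dart → ℝ} (hfix : bpStep G J h ν = ν) (d : G.Dart) :
    |ν d| < 1 := by
  rw [← hfix]
  exact abs_bpStep_lt_one ν d

lemma isLocallyConsistent_beliefs (hs : ∀ i j, G.Adj i j → J i j = J j i) {ν : G.Dart → ℝ}
    (hfix : bpStep G J h ν = ν) : IsLocallyConsistent G (beliefs G J h ν) := by
  have hν := abs_lt_one_of_fixed hfix
  rw [beliefs_eq_ofMoments hs (fun d => (hν d).le) hfix]
  exact isLocallyConsistent_ofMoments (fun i => (Real.abs_tanh_lt_one _).le)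
    (messageCorr_symm hs ν) fun d x y => (pairLaw_messageCorr_pos hs
      (matchesMeans_bpMean hs (fun d => (hν d).le) hfix) hν d x y).le

lemma betheFreeEnergy_beliefs (hs : ∀ i j, G.Adj i j → J i j = J j i) {ν : G.Dart → ℝ}
    (hfix : bpStep G J h ν = ν) :
    betheFreeEnergy G J h (beliefs G J h ν) = dualBetheFreeEnergy G J h ν := by
  have hν := abs_lt_one_of_fixed hfix
  have hm := matchesMeans_bpMean hs (fun d => (hν d).le) hfix
  rw [beliefs_eq_ofMoments hs (fun d => (hν d).le) hfix, betheFreeEnergy_messageCorr hs hm hν,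
    dualBetheFreeEnergy]
  congr 1
  refine Finset.sum_congr rfl fun i _ => ?_
  rw [dualVertexTerm_eq]
  congr 1
  exact spinEntropy_add_eq (h i) (fun e _ => abs_theta_mul_lt_one e (hν e).le) rfl

end bethe

/-! ### Reflecting the spins -/

lemma pairEntropy_eq (a b c : ℝ) : pairEntropy a b c =
    Real.negMulLog ((1 + c + (a + b)) / 4) + Real.negMulLog ((1 + c - (a + b)) / 4) +
      (Real.negMulLog ((1 - c + (a - b)) / 4) + Real.negMulLog ((1 - c - (a - b)) / 4)) := by
  have h1 : pairLaw a b c 1 1 = (1 + c + (a + b)) / 4 := by simp [pairLaw]; ring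
  have h2 : pairLaw a b c (-1) (-1) = (1 + c - (a + b)) / 4 := by simp [pairLaw]; ring
  have h3 : pairLaw a b c 1 (-1) = (1 - c + (a - b)) / 4 := by simp [pairLaw]; ring
  have h4 : pairLaw a b c (-1) 1 = (1 - c - (a - b)) / 4 := by simp [pairLaw]; ring
  rw [pairEntropy, sum_units, sum_units, sum_units, h1, h2, h3, h4]
  ring

lemma pairLaw_nonneg_iff {a b c : ℝ} :
    (∀ x y, 0 ≤ pairLaw a b c x y) ↔ |a + b| ≤ 1 + c ∧ |a - b| ≤ 1 - c := by
  constructor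
  · intro h
    have h1 := h 1 1
    have h2 := h 1 (-1)
    have h3 := h (-1) 1
    have h4 := h (-1) (-1)
    simp only [pairLaw, spin_one, spin_neg_one] at h1 h2 h3 h4
    exact ⟨abs_le.2 ⟨by linarith, by linarith⟩, abs_le.2 ⟨by linarith, by linarith⟩⟩
  · rintro ⟨h1, h2⟩ x y
    obtain ⟨h3, h4⟩ := abs_le.1 h1
    obtain ⟨h5, h6⟩ := abs_le.1 h2
    rw [pairLaw]
    rcases spin_eq x with hx | hx <;> rcases spin_eq y with hy | hy <;> rw [hx, hy] <;> linarith

lemma pairEntropy_neg_left (a b c : ℝ) : pairEntropy (-a) b (-c) = pairEntropy a b c := by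
  rw [pairEntropy_eq, pairEntropy_eq]
  ring_nf

lemma pairEntropy_neg_right (a b c : ℝ) : pairEntropy a (-b) (-c) = pairEntropy a b c := by
  rw [pairEntropy_eq, pairEntropy_eq]
  ring_nf

/-- The sign of the derivative reduces to $(1+c+s)(1-c-s)\le(1+c-s)(1-c+s)$, that is,
$(c-s)^2\le(c+s)^2$. -/
lemma monotoneOn_negMulLog_diff {c : ℝ} (hc : 0 ≤ c) :
    MonotoneOn (fun s => Real.negMulLog ((1 + c + s) / 4) + Real.negMulLog ((1 + c - s) / 4) -
      (Real.negMulLog ((1 - c + s) / 4) + Real.negMulLog ((1 - c - s) / 4)))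
      (Set.Icc 0 (1 - c)) := by
  have hderiv : ∀ s ∈ Set.Ioo (0 : ℝ) (1 - c), HasDerivAt
      (fun s => Real.negMulLog ((1 + c + s) / 4) + Real.negMulLog ((1 + c - s) / 4) -
        (Real.negMulLog ((1 - c + s) / 4) + Real.negMulLog ((1 - c - s) / 4)))
      ((Real.log ((1 + c - s) / 4) + Real.log ((1 - c + s) / 4) -
        (Real.log ((1 + c + s) / 4) + Real.log ((1 - c - s) / 4))) / 4) s := by
    rintro s ⟨hs0, hs1⟩
    have hadd : ∀ k : ℝ, HasDerivAt (fun s : ℝ => (k + s) / 4) (1 / 4) s := fun k =>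
      ((hasDerivAt_id s).const_add k).div_const 4
    have hsub : ∀ k : ℝ, HasDerivAt (fun s : ℝ => (k - s) / 4) (-1 / 4) s := fun k =>
      ((hasDerivAt_id s).const_sub k).div_const 4
    have e : ∀ {x : ℝ}, 0 < x → x / 4 ≠ 0 := fun hx => (div_pos hx (by norm_num)).ne'
    have d1 := (Real.hasDerivAt_negMulLog (e (by linarith : 0 < 1 + c + s))).comp s (hadd (1 + c))
    have d2 := (Real.hasDerivAt_negMulLog (e (by linarith : 0 < 1 + c - s))).comp s (hsub (1 + c))
    have d3 := (Real.hasDerivAt_negMulLog (e (by linarith : 0 < 1 - c + s))).comp s (hadd (1 - c))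
    have d4 := (Real.hasDerivAt_negMulLog (e (by linarith : 0 < 1 - c - s))).comp s (hsub (1 - c))
    exact ((d1.fun_add d2).fun_sub (d3.fun_add d4)).congr_deriv (by ring)
  refine monotoneOn_of_deriv_nonneg (convex_Icc _ _) ?_ ?_ ?_
  · have := Real.continuous_negMulLog
    fun_prop
  · intro s hs
    rw [interior_Icc] at hs
    exact (hderiv s hs).differentiableAt.differentiableWithinAt
  · intro s hs
    rw [interior_Icc] at hs
    rw [(hderiv s hs).deriv]
    obtain ⟨hs0, hs1⟩ := hs
    have e : ∀ {x : ℝ}, 0 < x → x / 4 ≠ 0 := fun hx => (div_pos hx (by norm_num)).ne'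
    refine div_nonneg (sub_nonneg.2 ?_) (by norm_num)
    rw [← Real.log_mul (e (by linarith)) (e (by linarith)),
      ← Real.log_mul (e (by linarith)) (e (by linarith))]
    refine Real.log_le_log (mul_pos (div_pos ?_ ?_) (div_pos ?_ ?_)) ?_ <;>
      nlinarith [mul_nonneg hc hs0.le]

/-- With $g$ the function of `monotoneOn_negMulLog_diff`, the difference of the two entropies is
$g(a+b)-g(a-b)$ once $b\le a$. -/
lemma pairEntropy_neg_le {a b c : ℝ} (ha : 0 ≤ a) (hb : 0 ≤ b) (hc : 0 ≤ c)
    (hab : a + b ≤ 1 - c) : pairEntropy a b (-c) ≤ pairEntropy a b c := by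
  wlog hle : b ≤ a generalizing a b
  · have h1 := this hb ha (by linarith) (not_le.1 hle).le
    have h2 : ∀ c, pairEntropy b a c = pairEntropy a b c := fun c => by
      rw [pairEntropy_eq, pairEntropy_eq]; ring_nf
    rwa [h2, h2] at h1
  have h1 := monotoneOn_negMulLog_diff hc (a := a - b) (b := a + b)
    ⟨by linarith, by linarith⟩ ⟨by linarith, by linarith⟩ (by linarith)
  simp only at h1
  rw [pairEntropy_eq, pairEntropy_eq, sub_neg_eq_add, ← sub_eq_add_neg]
  linarith

lemma pairLaw_abs_nonneg {a b c : ℝ} (h : ∀ x y, 0 ≤ pairLaw a b c x y) (x y : ℤˣ) :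
    0 ≤ pairLaw |a| |b| |c| x y := by
  revert x y
  rw [pairLaw_nonneg_iff] at h ⊢
  simp only [abs_le] at h ⊢
  rcases abs_cases a with ⟨h1, _⟩ | ⟨h1, _⟩ <;> rcases abs_cases b with ⟨h2, _⟩ | ⟨h2, _⟩ <;>
    rcases abs_cases c with ⟨h3, _⟩ | ⟨h3, _⟩ <;> rw [h1, h2, h3] <;>
    refine ⟨⟨?_, ?_⟩, ?_, ?_⟩ <;> linarith

/-- Replacing the moments by their absolute values does not decrease the entropy. -/
lemma pairEntropy_le_abs {a b c : ℝ} (h : ∀ x y, 0 ≤ pairLaw a b c x y) :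
    pairEntropy a b c ≤ pairEntropy |a| |b| |c| := by
  have core : ∀ {a b c : ℝ}, 0 ≤ a → 0 ≤ b → a + b ≤ 1 + c →
      pairEntropy a b c ≤ pairEntropy a b |c| := by
    intro a b c ha hb hab
    rcases le_total 0 c with hc | hc
    · rw [abs_of_nonneg hc]
    · rw [abs_of_nonpos hc]
      have := pairEntropy_neg_le ha hb (neg_nonneg.2 hc) (by linarith)
      rwa [neg_neg] at this
  rw [pairLaw_nonneg_iff, abs_le, abs_le] at h
  obtain ⟨⟨h1, h2⟩, h3, h4⟩ := h
  -- Flipping one spin negates its mean and the correlation and preserves the entropy, so every sign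
  -- pattern reduces to nonnegative means.
  rcases le_total 0 a with ha | ha <;> rcases le_total 0 b with hb | hb
  · rw [abs_of_nonneg ha, abs_of_nonneg hb]
    exact core ha hb h2
  · rw [abs_of_nonneg ha, abs_of_nonpos hb, ← pairEntropy_neg_right, ← abs_neg c]
    exact core ha (by linarith) (by linarith)
  · rw [abs_of_nonpos ha, abs_of_nonneg hb, ← pairEntropy_neg_left, ← abs_neg c]
    exact core (by linarith) hb (by linarith)
  · rw [abs_of_nonpos ha, abs_of_nonpos hb, ← pairEntropy_neg_left, ← pairEntropy_neg_right,
      neg_neg]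
    exact core (by linarith) (by linarith) (by linarith)

lemma spinEntropy_abs (a : ℝ) : spinEntropy |a| = spinEntropy a := by
  rcases abs_choice a with h | h <;> rw [h]
  simp [spinEntropy, spinLaw, add_comm]

/-! ### Messages with prescribed means -/

/-- Given $v$, the first equation has the solution $u=(a-tv)/(1-atv)$; given $u$, the second is
solved for $v$ likewise. The composite maps $[-1,1]$ continuously into $(-1,1)$, so the intermediate
value theorem gives it a fixed point. -/
lemma exists_edgeMean_eq {t a b : ℝ} (ht : |t| < 1) (ha : |a| < 1) (hb : |b| < 1) :
    ∃ u v, |u| < 1 ∧ |v| < 1 ∧ a = edgeMean t u v ∧ b = edgeMean t v u := by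
  have hden : ∀ {a v : ℝ}, |a| < 1 → |v| ≤ 1 → 0 < 1 - a * (t * v) := fun ha hv => by
    linarith [(abs_lt.1 (abs_mul_lt_one ha (abs_mul_lt_one ht hv).le)).2]
  have hf : ∀ {a v : ℝ}, |a| < 1 → |v| ≤ 1 → |(a - t * v) / (1 - a * (t * v))| < 1 := by
    intro a v ha hv
    have h1 := hden ha hv
    obtain ⟨h2, h3⟩ := abs_lt.1 ha
    obtain ⟨h4, h5⟩ := abs_lt.1 (abs_mul_lt_one ht hv)
    rw [abs_lt, lt_div_iff₀ h1, div_lt_iff₀ h1]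
    constructor <;> nlinarith
  set g : ℝ → ℝ := fun v => (a - t * v) / (1 - a * (t * v)) with hg
  have hgc : ContinuousOn g (Set.Icc (-1) 1) := by
    refine ContinuousOn.div (by fun_prop) (by fun_prop) fun v hv => ?_
    exact (hden ha (abs_le.2 hv)).ne'
  have hFc : ContinuousOn (fun v => (b - t * g v) / (1 - b * (t * g v)) - v)
      (Set.Icc (-1) 1) := by
    refine ContinuousOn.sub (ContinuousOn.div (by fun_prop) (by fun_prop) fun v hv => ?_)
      continuousOn_id
    exact (hden hb (hf ha (abs_le.2 hv)).le).ne'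
  have hb1 := hf hb (hf ha (v := 1) (by simp)).le
  have hb2 := hf hb (hf ha (v := -1) (by simp)).le
  obtain ⟨v, hv, hv0⟩ := intermediate_value_Icc' (by norm_num) hFc
    (⟨by linarith [(abs_lt.1 hb1).2], by linarith [(abs_lt.1 hb2).1]⟩ : (0 : ℝ) ∈ Set.Icc _ _)
  have hv1 : |v| ≤ 1 := abs_le.2 hv
  have hu : |g v| < 1 := hf ha hv1
  have hv2 : v = (b - t * g v) / (1 - b * (t * g v)) := (sub_eq_zero.1 hv0).symm
  have hvlt : |v| < 1 := by rw [hv2]; exact hf hb hu.le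
  have e1 : g v * (1 - a * (t * v)) = a - t * v := div_mul_cancel₀ _ (hden ha hv1).ne'
  have e2 : v * (1 - b * (t * g v)) = b - t * g v := by
    rw [eq_div_iff (hden hb hu.le).ne'] at hv2
    exact hv2
  refine ⟨g v, v, hu, hvlt, ?_, ?_⟩
  · rw [edgeMean, eq_div_iff (one_add_mul_pos ht hu.le hv1).ne']
    linear_combination -e1
  · rw [edgeMean, eq_div_iff (one_add_mul_pos ht hv1 hu.le).ne']
    linear_combination -e2

lemma exists_matchesMeans (hs : ∀ i j, G.Adj i j → J i j = J j i) {m : V → ℝ}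
    (hm : ∀ i, |m i| < 1) : ∃ ν : G.Dart → ℝ, (∀ d, |ν d| < 1) ∧ MatchesMeans G J m ν := by
  -- An arbitrary linear order orients the edges, so that both messages of an edge come from the
  -- same solution pair.
  obtain ⟨_, _⟩ := exists_wellFoundedLT V
  choose u v hu hv hmu hmv using fun d : G.Dart =>
    exists_edgeMean_eq (abs_theta_lt_one (J := J) d) (hm d.fst) (hm d.snd)
  refine ⟨fun d => if d.fst < d.snd then u d else v d.symm, fun d => ?_, fun d => ?_⟩
  · dsimp only
    split_ifs
    exacts [hu d, hv d.symm]
  · dsimp only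
    rw [fst_symm, snd_symm, SimpleGraph.Dart.symm_symm]
    rcases lt_or_gt_of_ne d.adj.ne with hlt | hlt
    · rw [if_pos hlt, if_neg hlt.not_gt]
      exact hmu d
    · rw [if_neg hlt.not_gt, if_pos hlt, ← theta_symm hs]
      exact hmv d.symm

/-- In `artanh` coordinates a mean is the sum of the message sent and the filtered message received
along any one edge. -/
lemma artanh_mean (hs : ∀ i j, G.Adj i j → J i j = J j i) {m : V → ℝ} {ν : G.Dart → ℝ}
    (hm : MatchesMeans G J m ν) (hν : ∀ d, |ν d| < 1) (e : G.Dart) :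
    Real.artanh (ν e.symm) = Real.artanh (m e.snd) - Real.artanh (theta G J e * ν e) := by
  have h1 := tanh_add_artanh (Real.artanh (ν e.symm)) (abs_theta_mul_lt_one (J := J) e (hν e).le)
  rw [Real.tanh_artanh (abs_lt.1 (hν _))] at h1
  have h2 : m e.snd = Real.tanh (Real.artanh (ν e.symm) + Real.artanh (theta G J e * ν e)) := by
    rw [h1, hm.snd hs, edgeMean]
    congr 2
    ring
  rw [h2, Real.artanh_tanh]
  ring

/-! ### Perturbing the node means -/

lemma artanh_eq_half_log_sub {x : ℝ} (hx : |x| < 1) :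
    Real.artanh x = (Real.log (1 + x) - Real.log (1 - x)) / 2 := by
  obtain ⟨h1, h2⟩ := abs_lt.1 hx
  rw [Real.artanh_eq_half_log ⟨h1.le, h2.le⟩, Real.log_div (by linarith) (by linarith)]
  ring

lemma hasDerivAt_spinEntropy {a : ℝ} (ha : |a| < 1) (p : ℝ) :
    HasDerivAt (fun s : ℝ => spinEntropy (a + s * p)) (-(p * Real.artanh a)) 0 := by
  have h1 : ∀ x : ℤˣ, HasDerivAt (fun s : ℝ => Real.negMulLog (spinLaw (a + s * p) x))
      ((-Real.log (spinLaw a x) - 1) * (p * spin x / 2)) 0 := by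
    intro x
    have h2 : HasDerivAt (fun s : ℝ => spinLaw (a + s * p) x) (p * spin x / 2) 0 := by
      have := (((((hasDerivAt_id (0 : ℝ)).mul_const p).const_add a).mul_const
        (spin x)).const_add 1).div_const 2
      simpa [spinLaw] using this
    have h3 : spinLaw (a + 0 * p) x = spinLaw a x := by simp
    have h4 : spinLaw a x ≠ 0 := (div_pos (one_add_mul_spin_pos ha x) two_pos).ne'
    have h5 := Real.hasDerivAt_negMulLog (h3.symm ▸ h4)
    have h6 := h5.comp (0 : ℝ) h2
    rwa [h3] at h6
  refine (HasDerivAt.fun_sum fun x (_ : x ∈ Finset.univ) => h1 x).congr_deriv ?_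
  obtain ⟨h2, h3⟩ := abs_lt.1 ha
  rw [sum_units, spinLaw, spinLaw, spin_one, spin_neg_one, artanh_eq_half_log_sub ha,
    Real.log_div (by linarith) two_ne_zero, Real.log_div (by linarith) two_ne_zero, mul_one,
    mul_neg_one, ← sub_eq_add_neg]
  ring

/-- The correlation is held fixed. The log-density is a combination of $xy$, a constant and the two
single-spin logarithms; summed against $px+qy$, only the latter survive, and they give `artanh u`
and `artanh v`. -/
lemma hasDerivAt_pairEntropy {J a b c u v : ℝ} (hu : |u| < 1) (hv : |v| < 1)
    (hpos : ∀ x y, 0 < pairLaw a b c x y)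
    (hw : ∀ x y, pairLaw a b c x y =
      pairWeight J u v x y / ∑ x, ∑ y, pairWeight J u v x y) (p q : ℝ) :
    HasDerivAt (fun s : ℝ => pairEntropy (a + s * p) (b + s * q) c)
      (-(p * Real.artanh u + q * Real.artanh v)) 0 := by
  have h1 : ∀ x y : ℤˣ, HasDerivAt
      (fun s : ℝ => Real.negMulLog (pairLaw (a + s * p) (b + s * q) c x y))
      ((-Real.log (pairLaw a b c x y) - 1) * ((p * spin x + q * spin y) / 4)) 0 := by
    intro x y
    have h2 : HasDerivAt (fun s : ℝ => pairLaw (a + s * p) (b + s * q) c x y)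
        ((p * spin x + q * spin y) / 4) 0 := by
      have e1 := (((hasDerivAt_id (0 : ℝ)).mul_const p).const_add a).mul_const (spin x)
      have e2 := (((hasDerivAt_id (0 : ℝ)).mul_const q).const_add b).mul_const (spin y)
      have := (((e1.const_add 1).fun_add e2).add_const (c * (spin x * spin y))).div_const 4
      simpa [pairLaw] using this
    have h3 : pairLaw (a + 0 * p) (b + 0 * q) c x y = pairLaw a b c x y := by simp
    have h5 := Real.hasDerivAt_negMulLog (h3.symm ▸ (hpos x y).ne')
    have h6 := h5.comp (0 : ℝ) h2
    rwa [h3] at h6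
  refine (HasDerivAt.fun_sum fun x (_ : x ∈ Finset.univ) =>
    HasDerivAt.fun_sum fun y (_ : y ∈ Finset.univ) => h1 x y).congr_deriv ?_
  have hZ : 0 < ∑ x, ∑ y, pairWeight J u v x y :=
    Finset.sum_pos (fun x _ => Finset.sum_pos (fun y _ => pairWeight_pos hu hv x y)
      Finset.univ_nonempty) Finset.univ_nonempty
  have hlog : ∀ x y, Real.log (pairLaw a b c x y) = J * (spin x * spin y) +
      Real.log (1 + u * spin x) + Real.log (1 + v * spin y) -
        Real.log (∑ x, ∑ y, pairWeight J u v x y) := by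
    intro x y
    have h2 := one_add_mul_spin_pos hu x
    have h3 := one_add_mul_spin_pos hv y
    rw [hw, Real.log_div (pairWeight_pos hu hv x y).ne' hZ.ne', pairWeight,
      Real.log_mul (by positivity) h3.ne', Real.log_mul (by positivity) h2.ne', Real.log_exp]
  simp only [hlog]
  generalize Real.log (∑ x, ∑ y, pairWeight J u v x y) = Z
  simp only [sum_units, spin_one, spin_neg_one, artanh_eq_half_log_sub hu,
    artanh_eq_half_log_sub hv, mul_one, mul_neg_one, ← sub_eq_add_neg]
  ring

/-- The moments of locally consistent distributions whose node means are at most `r`. -/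
def momentBox (G : SimpleGraph V) (r : ℝ) : Set ((V → ℝ) × (G.Dart → ℝ)) :=
  {q | (∀ i, |q.1 i| ≤ r) ∧ (∀ d, q.2 d.symm = q.2 d) ∧
    ∀ d x y, 0 ≤ pairLaw (q.1 d.fst) (q.1 d.snd) (q.2 d) x y}

lemma isLocallyConsistent_of_mem_momentBox {r : ℝ} (hr : r ≤ 1) {q : (V → ℝ) × (G.Dart → ℝ)}
    (hq : q ∈ momentBox G r) : IsLocallyConsistent G (ofMoments G q.1 q.2) :=
  isLocallyConsistent_ofMoments (fun i => (hq.1 i).trans hr) hq.2.1 hq.2.2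

lemma isCompact_momentBox (r : ℝ) : IsCompact (momentBox G r) := by
  refine IsCompact.of_isClosed_subset
    (isCompact_Icc (a := ((fun _ => -r, fun _ => -1) : (V → ℝ) × (G.Dart → ℝ)))
      (b := (fun _ => r, fun _ => 1))) ?_ ?_
  · simp only [momentBox, pairLaw, Set.ofPred_and, Set.ofPred_forall]
    refine IsClosed.inter ?_ (IsClosed.inter ?_ ?_)
    · exact isClosed_iInter fun i => isClosed_le (by fun_prop) (by fun_prop)
    · exact isClosed_iInter fun d => isClosed_eq (by fun_prop) (by fun_prop)
    · exact isClosed_iInter fun d => isClosed_iInter fun x => isClosed_iInter fun y =>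
        isClosed_le (by fun_prop) (by fun_prop)
  · rintro q ⟨h1, -, h3⟩
    have h4 : ∀ d, -1 ≤ q.2 d ∧ q.2 d ≤ 1 := fun d => by
      obtain ⟨h5, h6⟩ := pairLaw_nonneg_iff.1 (h3 d)
      exact ⟨by linarith [abs_nonneg (q.1 d.fst + q.1 d.snd)],
        by linarith [abs_nonneg (q.1 d.fst - q.1 d.snd)]⟩
    exact ⟨⟨fun i => (abs_le.1 (h1 i)).1, fun d => (h4 d).1⟩,
      ⟨fun i => (abs_le.1 (h1 i)).2, fun d => (h4 d).2⟩⟩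

/-! ### Maximizers of the Bethe free energy over a moment box -/

section optimum

variable [Fintype V] [DecidableEq V] [DecidableRel G.Adj]

/-- By `artanh_mean`, the edges at `i` contribute `-deg i` copies of `artanh (m i)` plus the
filtered incoming messages. The node entropies return `deg i - 1` copies, so one remains with a
minus sign. -/
lemma hasDerivAt_betheFreeEnergy (hs : ∀ i j, G.Adj i j → J i j = J j i) {m : V → ℝ}
    {ν : G.Dart → ℝ} (hm : ∀ i, |m i| < 1) (hν : ∀ d, |ν d| < 1) (hmν : MatchesMeans G J m ν)
    (δ : V → ℝ) :
    HasDerivAt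
      (fun s : ℝ => betheFreeEnergy G J h (ofMoments G (m + s • δ) (messageCorr G J ν)))
      (∑ i, δ i * (h i + ∑ e ∈ incoming G i, Real.artanh (theta G J e * ν e) -
        Real.artanh (m i))) 0 := by
  simp only [betheFreeEnergy_ofMoments]
  have hedge : ∀ d : G.Dart, HasDerivAt (fun s : ℝ => J d.fst d.snd * messageCorr G J ν d +
      pairEntropy ((m + s • δ) d.fst) ((m + s • δ) d.snd) (messageCorr G J ν d))
      (-(δ d.fst * Real.artanh (ν d) + δ d.snd * Real.artanh (ν d.symm))) 0 := fun d =>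
    (hasDerivAt_pairEntropy (hν d) (hν d.symm) (pairLaw_messageCorr_pos hs hmν hν d)
      (pairLaw_messageCorr hs hmν (fun d => (hν d).le) d) (δ d.fst) (δ d.snd)).const_add _
  have hfield : ∀ i, HasDerivAt (fun s : ℝ => h i * (m + s • δ) i) (h i * δ i) 0 := by
    intro i
    have := ((((hasDerivAt_id (0 : ℝ)).mul_const (δ i)).const_add (m i))).const_mul (h i)
    simpa using this
  have hnode : ∀ i, HasDerivAt
      (fun s : ℝ => ((G.degree i : ℝ) - 1) * spinEntropy ((m + s • δ) i))
      (((G.degree i : ℝ) - 1) * -(δ i * Real.artanh (m i))) 0 := fun i =>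
    (hasDerivAt_spinEntropy (hm i) (δ i)).const_mul _
  have h1 := ((((HasDerivAt.fun_sum fun d (_ : d ∈ Finset.univ) => hedge d).const_mul
    (1 / 2)).fun_add (HasDerivAt.fun_sum fun i (_ : i ∈ Finset.univ) => hfield i)).fun_sub
      (HasDerivAt.fun_sum fun i (_ : i ∈ Finset.univ) => hnode i))
  refine h1.congr_deriv ?_
  have h2 : (1 / 2) * ∑ d : G.Dart,
      -(δ d.fst * Real.artanh (ν d) + δ d.snd * Real.artanh (ν d.symm)) =
      ∑ i, -(δ i * (G.degree i * Real.artanh (m i) -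
        ∑ e ∈ incoming G i, Real.artanh (theta G J e * ν e))) := by
    have h3 := edgeSum_add_symm fun d : G.Dart => -(δ d.snd * Real.artanh (ν d.symm))
    rw [← sum_incoming, edgeSum] at h3
    simp only [snd_symm, SimpleGraph.Dart.symm_symm] at h3
    have h4 : ∀ d : G.Dart, -(δ d.fst * Real.artanh (ν d) + δ d.snd * Real.artanh (ν d.symm)) =
      -(δ d.snd * Real.artanh (ν d.symm)) + -(δ d.fst * Real.artanh (ν d)) := fun d => by ring
    simp only [h4, h3]
    refine Finset.sum_congr rfl fun i _ => ?_
    have h5 : ∀ e ∈ incoming G i, -(δ e.snd * Real.artanh (ν e.symm)) =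
        -(δ i * (Real.artanh (m i) - Real.artanh (theta G J e * ν e))) := by
      intro e he
      rw [artanh_mean hs hmν hν, mem_incoming.1 he]
    rw [Finset.sum_congr rfl h5, Finset.sum_neg_distrib, ← Finset.mul_sum,
      Finset.sum_sub_distrib, Finset.sum_const, card_incoming, nsmul_eq_mul]
  rw [h2, ← Finset.sum_add_distrib, ← Finset.sum_sub_distrib]
  exact Finset.sum_congr rfl fun i _ => by ring

lemma continuous_betheFreeEnergy : Continuous fun q : (V → ℝ) × (G.Dart → ℝ) =>
    betheFreeEnergy G J h (ofMoments G q.1 q.2) := by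
  have := Real.continuous_negMulLog
  simp only [betheFreeEnergy_ofMoments, edgeSum, pairEntropy, spinEntropy, pairLaw, spinLaw]
  fun_prop

/-- Replacing all moments by their absolute values does not decrease the free energy. -/
lemma betheFreeEnergy_le_abs (hJ : ∀ i j, G.Adj i j → 0 ≤ J i j) (hh : ∀ i, 0 ≤ h i)
    {r : ℝ} {q : (V → ℝ) × (G.Dart → ℝ)} (hq : q ∈ momentBox G r) :
    betheFreeEnergy G J h (ofMoments G q.1 q.2) ≤
      betheFreeEnergy G J h (ofMoments G (fun i => |q.1 i|) fun d => |q.2 d|) := by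
  simp only [betheFreeEnergy_ofMoments, spinEntropy_abs]
  have h1 : ∀ d : G.Dart,
      J d.fst d.snd * q.2 d + pairEntropy (q.1 d.fst) (q.1 d.snd) (q.2 d) ≤
      J d.fst d.snd * |q.2 d| + pairEntropy |q.1 d.fst| |q.1 d.snd| |q.2 d| := fun d =>
    add_le_add (mul_le_mul_of_nonneg_left (le_abs_self _) (hJ _ _ d.adj))
      (pairEntropy_le_abs (hq.2.2 d))
  have h2 : ∑ i, h i * q.1 i ≤ ∑ i, h i * |q.1 i| :=
    Finset.sum_le_sum fun i _ => mul_le_mul_of_nonneg_left (le_abs_self _) (hh i)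
  linarith [edgeSum_le_edgeSum h1]

lemma exists_nonneg_maximizer (hJ : ∀ i j, G.Adj i j → 0 ≤ J i j) (hh : ∀ i, 0 ≤ h i)
    {r : ℝ} (hr : 0 ≤ r) : ∃ q ∈ momentBox G r, (∀ i, 0 ≤ q.1 i) ∧
      IsMaxOn (fun q : (V → ℝ) × (G.Dart → ℝ) => betheFreeEnergy G J h (ofMoments G q.1 q.2))
        (momentBox G r) q := by
  obtain ⟨q, hq, hmax⟩ := (isCompact_momentBox (G := G) r).exists_isMaxOn
    ⟨0, fun i => by simpa using hr, fun d => rfl, fun d x y => by simp [pairLaw]⟩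
    (continuous_betheFreeEnergy (J := J) (h := h)).continuousOn
  refine ⟨(fun i => |q.1 i|, fun d => |q.2 d|), ⟨fun i => by simpa using hq.1 i,
    fun d => by simp only [hq.2.1 d], fun d => pairLaw_abs_nonneg (hq.2.2 d)⟩,
    fun i => abs_nonneg _, fun p hp => ?_⟩
  exact le_trans (hmax hp) (betheFreeEnergy_le_abs hJ hh hq)

/-- At a nonnegative maximizer the node means lie below their updates. -/
lemma artanh_le_of_maximizer (hs : ∀ i j, G.Adj i j → J i j = J j i) {r : ℝ} (hr0 : 0 < r)
    (hr1 : r < 1) {q : (V → ℝ) × (G.Dart → ℝ)} (hq : q ∈ momentBox G r) (hq0 : ∀ i, 0 ≤ q.1 i)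
    (hmax : IsMaxOn (fun q : (V → ℝ) × (G.Dart → ℝ) =>
      betheFreeEnergy G J h (ofMoments G q.1 q.2)) (momentBox G r) q)
    {ν : G.Dart → ℝ} (hν : ∀ d, |ν d| < 1) (hmν : MatchesMeans G J q.1 ν) (i : V) :
    Real.artanh (q.1 i) ≤
      h i + ∑ e ∈ incoming G i, Real.artanh (theta G J e * ν e) := by
  have hm : ∀ i, |q.1 i| < 1 := fun i => (hq.1 i).trans_lt hr1
  -- Only lowering is surely admissible: a mean in $[0,r]$ stays in $[-r,r]$ under a small decrease,
  -- even at either end of $[0,r]$.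
  set δ : V → ℝ := Pi.single i (-1) with hδ
  have hd := hasDerivAt_betheFreeEnergy (h := h) hs hm hν hmν δ
  have hsum : ∑ k, δ k * (h k + ∑ e ∈ incoming G k, Real.artanh (theta G J e * ν e) -
      Real.artanh (q.1 k)) = -(h i + ∑ e ∈ incoming G i, Real.artanh (theta G J e * ν e) -
        Real.artanh (q.1 i)) := by
    rw [Finset.sum_eq_single i]
    · rw [hδ, Pi.single_eq_same]; ring
    · intro k _ hk
      rw [hδ, Pi.single_eq_of_ne hk, zero_mul]
    · simp
  rw [hsum] at hd
  -- The perturbation starts from the message correlations, not from `q.2`: their edge laws are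
  -- strictly positive, so small changes of the means keep them nonnegative.
  have hev : ∀ᶠ s : ℝ in 𝓝[>] 0, ((q.1 + s • δ, messageCorr G J ν) :
      (V → ℝ) × (G.Dart → ℝ)) ∈ momentBox G r := by
    have e1 : ∀ᶠ s : ℝ in 𝓝 0, ∀ d x y, 0 < pairLaw ((q.1 + s • δ) d.fst)
        ((q.1 + s • δ) d.snd) (messageCorr G J ν d) x y := by
      refine eventually_all.2 fun d => eventually_all.2 fun x => eventually_all.2 fun y => ?_
      have hc : Continuous fun s : ℝ => pairLaw ((q.1 + s • δ) d.fst)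
          ((q.1 + s • δ) d.snd) (messageCorr G J ν d) x y := by
        simp only [pairLaw, Pi.add_apply, Pi.smul_apply, smul_eq_mul]
        fun_prop
      refine hc.continuousAt.eventually (lt_mem_nhds ?_)
      simpa using pairLaw_messageCorr_pos hs hmν hν d x y
    filter_upwards [e1.filter_mono nhdsWithin_le_nhds, self_mem_nhdsWithin,
      nhdsWithin_le_nhds (gt_mem_nhds hr0)] with s hs1 hs2 hs3
    refine ⟨fun k => ?_, messageCorr_symm hs ν, fun d x y => (hs1 d x y).le⟩
    by_cases hk : k = i
    · subst hk
      have h1 := hq0 k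
      have h2 := (abs_le.1 (hq.1 k)).2
      simp only [Set.mem_Ioi] at hs2
      simp only [hδ, Pi.add_apply, Pi.smul_apply, Pi.single_eq_same, smul_eq_mul]
      exact abs_le.2 ⟨by linarith, by linarith⟩
    · simpa [hδ, Pi.single_eq_of_ne hk] using hq.1 k
  have hle := le_of_tendsto hd.tendsto_slope_zero_right (b := 0) (by
    filter_upwards [hev, self_mem_nhdsWithin] with s hs1 hs2
    refine smul_nonpos_of_nonneg_of_nonpos (inv_nonneg.2 (le_of_lt hs2)) (sub_nonpos.2 ?_)
    simp only [zero_add, zero_smul, add_zero]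
    -- The perturbed value is at most that of `q`, which is at most the value at the same means with
    -- message correlations, so the one-sided derivative there is nonpositive.
    exact (hmax hs1).trans (betheFreeEnergy_le_messageCorr hs hmν hν
      (isLocallyConsistent_of_mem_momentBox hr1.le hq)))
  linarith

/-- Locally consistent distributions with node means bounded away from `±1` are dominated by
the dual Bethe free energy of some post-fixpoint. -/
lemma exists_postFixpoint_ge (hs : ∀ i j, G.Adj i j → J i j = J j i)
    (hJ : ∀ i j, G.Adj i j → 0 ≤ J i j) (hh : ∀ i, 0 ≤ h i) {r : ℝ} (hr0 : 0 < r) (hr1 : r < 1) :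
    ∃ ν ∈ postFixpoints G J h, ∀ q ∈ momentBox G r,
      betheFreeEnergy G J h (ofMoments G q.1 q.2) ≤ dualBetheFreeEnergy G J h ν := by
  obtain ⟨q, hq, hq0, hmax⟩ := exists_nonneg_maximizer hJ hh hr0.le
  obtain ⟨ν, hν, hmν⟩ := exists_matchesMeans hs fun i => (hq.1 i).trans_lt hr1
  have hν1 : ∀ d, |ν d| ≤ 1 := fun d => (hν d).le
  have hpost : ν ≤ bpStep G J h ν := by
    intro d
    have h1 := artanh_le_of_maximizer hs hr0 hr1 hq hq0 hmax hν hmν d.fst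
    have h2 := artanh_mean hs hmν hν d.symm
    rw [SimpleGraph.Dart.symm_symm, snd_symm] at h2
    -- Removing the contribution of `d.symm` from both sides turns the inequality for the mean into
    -- $\nu\le\phi(\nu)$ on `d`.
    rw [← Finset.sum_erase_add _ _ (symm_mem_incoming d)] at h1
    rw [bpStep_apply, ← Real.tanh_artanh (abs_lt.1 (hν d)), h2]
    exact tanh_le_tanh (by linarith)
  have hpair : ∀ d, ν d < 0 → 0 ≤ ν d.symm := by
    intro d hd
    by_contra hd'
    rw [not_le] at hd'
    -- Two negative messages on an edge would give the mean $(u+tv)/(1+tuv)$ a negative numerator,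
    -- as $t\ge0$.
    have h1 := hq0 d.fst
    rw [hmν d, edgeMean] at h1
    have h2 := one_add_mul_pos (abs_theta_lt_one (J := J) d) (hν1 d) (hν1 d.symm)
    have h3 := mul_nonpos_of_nonneg_of_nonpos (theta_nonneg hJ d) hd'.le
    exact absurd h1 (not_le.2 (div_neg_of_neg_of_pos (by linarith) h2))
  refine ⟨ν ⊔ 0, sup_zero_mem_postFixpoints hJ hh hν1 hpost, fun p hp => ?_⟩
  calc _ ≤ betheFreeEnergy G J h (ofMoments G q.1 q.2) := hmax hp
    _ ≤ dualBetheFreeEnergy G J h ν :=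
      betheFreeEnergy_le_dual hs hmν hν (isLocallyConsistent_of_mem_momentBox hr1.le hq)
    _ ≤ _ := dualBetheFreeEnergy_le_sup_zero hs hJ hν1 hpost hpair

lemma betheFreeEnergy_le_of_forall_postFixpoints (hs : ∀ i j, G.Adj i j → J i j = J j i)
    (hJ : ∀ i j, G.Adj i j → 0 ≤ J i j) (hh : ∀ i, 0 ≤ h i) {B : ℝ}
    (hB : ∀ ν ∈ postFixpoints G J h, dualBetheFreeEnergy G J h ν ≤ B) {P : Marginals G}
    (hP : IsLocallyConsistent G P) : betheFreeEnergy G J h P ≤ B := by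
  have hPm := eq_ofMoments hP
  rw [hPm] at hP ⊢
  generalize nodeMean P = m at *
  generalize edgeCorr P = c at *
  -- Scaling all moments by $1-s$ mixes the distribution with the uniform one, which puts it in the
  -- moment box of radius $1-s<1$; continuity recovers the case $s=0$.
  have hcont : Continuous fun s : ℝ =>
      betheFreeEnergy G J h (ofMoments G ((1 - s) • m) ((1 - s) • c)) :=
    (continuous_betheFreeEnergy (G := G) (J := J) (h := h)).comp
      (f := fun s : ℝ => (((1 - s) • m, (1 - s) • c) : (V → ℝ) × (G.Dart → ℝ))) (by fun_prop)
  have hlim := (hcont.tendsto 0).mono_left (nhdsWithin_le_nhds (s := Set.Ioi 0))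
  simp only [sub_zero, one_smul] at hlim
  refine le_of_tendsto hlim ?_
  filter_upwards [self_mem_nhdsWithin, nhdsWithin_le_nhds (gt_mem_nhds one_pos)] with s hs0 hs1
  rw [Set.mem_Ioi] at hs0
  obtain ⟨ν, hν, hle⟩ := exists_postFixpoint_ge hs hJ hh (r := 1 - s) (by linarith) (by linarith)
  refine (hle ((1 - s) • m, (1 - s) • c) ⟨fun i => ?_, fun d => ?_, fun d x y => ?_⟩).trans
    (hB ν hν)
  · have h1 := abs_le_one_of_isLocallyConsistent hP i
    simp only [Pi.smul_apply, smul_eq_mul]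
    rw [abs_mul, abs_of_pos (by linarith)]
    exact mul_le_of_le_one_right (by linarith) h1
  · simp only [Pi.smul_apply, corr_symm_of_isLocallyConsistent hP]
  · have h1 : 0 ≤ pairLaw (m d.fst) (m d.snd) (c d) x y := hP.edge_nonneg d x y
    have h2 : pairLaw ((1 - s) * m d.fst) ((1 - s) * m d.snd) ((1 - s) * c d) x y =
      (1 - s) * pairLaw (m d.fst) (m d.snd) (c d) x y + s / 4 := by
      simp only [pairLaw]; ring
    simp only [Pi.smul_apply, smul_eq_mul, h2]
    have := mul_nonneg (by linarith : 0 ≤ 1 - s) h1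
    linarith

end optimum

end IsingBP

end

theorem mainTheorem3 {V : Type*} [Fintype V] [DecidableEq V]
    (G : SimpleGraph V) [DecidableRel G.Adj] (J : V → V → ℝ) (h : V → ℝ)
    (hJsymm : ∀ i j, G.Adj i j → J i j = J j i)
    (hJ : ∀ i j, G.Adj i j → 0 ≤ J i j) (hh : ∀ i, 0 ≤ h i) :
    ∃ νstar : G.Dart → ℝ,
      -- BP from the all-ones messages decreases coordinatewise and converges to `νstar`
      Antitone (IsingBP.bpIter G J h) ∧
      Tendsto (IsingBP.bpIter G J h) atTop (𝓝 νstar) ∧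
      -- `νstar` is the greatest fixed point, and is nonnegative
      IsGreatest (IsingBP.bpFixedPoints G J h) νstar ∧
      0 ≤ νstar ∧
      -- `νstar` maximizes the dual Bethe free energy over the post-fixpoints
      νstar ∈ IsingBP.postFixpoints G J h ∧
      IsMaxOn (IsingBP.dualBetheFreeEnergy G J h) (IsingBP.postFixpoints G J h) νstar ∧
      -- the corresponding locally consistent distribution is a global maximizer of the Bethe
      -- free energy, and the BP estimate of the free energy is the maximum
      IsingBP.IsLocallyConsistent G (IsingBP.beliefs G J h νstar) ∧
      IsMaxOn (IsingBP.betheFreeEnergy G J h) {P | IsingBP.IsLocallyConsistent G P}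
        (IsingBP.beliefs G J h νstar) ∧
      IsingBP.dualBetheFreeEnergy G J h νstar =
        IsingBP.betheFreeEnergy G J h (IsingBP.beliefs G J h νstar) := by
  obtain ⟨νstar, hlim, h0, hfix, hgreat⟩ := IsingBP.exists_tendsto_bpIter (G := G) hJ hh
  have hpost : νstar ∈ IsingBP.postFixpoints G J h := ⟨h0, hfix.ge⟩
  have hdual : IsMaxOn (IsingBP.dualBetheFreeEnergy G J h) (IsingBP.postFixpoints G J h)
      νstar := fun ν hν =>
    IsingBP.dualBetheFreeEnergy_le_of_mem_postFixpoints hJsymm hJ hh hν hpost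
      (hgreat ν (IsingBP.abs_le_one_of_mem_postFixpoints hν) hν.2)
  have heq := IsingBP.betheFreeEnergy_beliefs hJsymm hfix
  refine ⟨νstar, IsingBP.antitone_bpIter hJ hh, hlim, ⟨⟨fun d => ?_, hfix⟩, ?_⟩, h0, hpost,
    hdual, IsingBP.isLocallyConsistent_beliefs hJsymm hfix, fun P hP => ?_, heq.symm⟩
  · exact abs_le.1 (IsingBP.abs_lt_one_of_fixed hfix d).le
  · rintro μ ⟨hμ, hμfix⟩
    exact hgreat μ (fun d => abs_le.2 (hμ d)) hμfix.ge
  · rw [Set.mem_ofPred_eq, heq]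
    exact IsingBP.betheFreeEnergy_le_of_forall_postFixpoints hJsymm hJ hh
      (fun ν hν => hdual hν) hP
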